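/- Let $\Bbbk$ be any field, let $I\subseteq \Bbbk[\mathbf x]=\Bbbk[x_1,\dots,x_n]$ be a monomial ideal, and for $\mathbf b\in\mathbb N^n$ let $$K^{\mathbf b}I=\{\tau\subseteq\{1,\dots,n\} : \mathbf x^{\mathbf b-\tau}\in I\}$$ be its (upper) Koszul simplicial complex, where $\tau$ is identified with its characteristic vector. All chains $\widetilde C_i$, cycles $\widetilde Z_i$, boundaries $\widetilde B_i$ and homology groups $\widetilde H_i$ are reduced simplicial ones over $\Bbbk$, with boundary maps $\partial_i:\widetilde C_i\to\widetilde C_{i-1}$; $K_i$ is the set of $i$-faces of $K$, and $(-1)^{\sigma\subset\tau}$ is the coefficient of the facet $\sigma$ in $\partial\tau$. **Hedges and communities.** Let $K$ be a simplicial complex. A *shrubbery* in dimension $i$ is a set $T_i\subseteq K_i$ such that $\partial_i$ restricts to an isomorphism $\Bbbk\{T_i\}\to\widetilde B_{i-1}K$. A *stake set* in dimension $i$ is a set $S_i\subseteq K_i$ such that the coordinate projection $\widetilde C_iK\to\Bbbk\{S_i\}$ restricts to an isomorphism $\widetilde B_iK\to\Bbbk\{S_i\}$. A *hedge* of dimension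 $i$ is a pair $ST_i=(S_{i-1},T_i)$. A *community* in $K$ is a sequence of hedges $ST_0,ST_1,ST_2,\dots$ with $T_i\cap S_i=\varnothing$ for all $i$. (The shrubbery $T_{-1}$ is always the empty set of faces.) Given these data: * the *circuit* of $\sigma\in K_i$ is the unique cycle $z\in\widetilde Z_iK$ with $\sigma-z\in\Bbbk\{T_i\}$; write $c_\sigma(\sigma',T_i)$ for its coefficient on $\sigma'$; * the *shrub* of a stake $\sigma\in S_{i-1}$ is the unique chain $s\in\Bbbk\{T_i\}$ whose boundary has coefficient $1$ on $\sigma$ and $0$ on all other stakes in $S_{i-1}$; write $c_\sigma(\tau,ST_i)$ for its coefficient on $\tau$; * the *hedge rim* of $\rho\in K_i$ is the unique chain $r\in\Bbbk\{K_i\setminus S_i\}$ with $\rho-r\in\widetilde B_iK$; write $c_\rho(\rho',S_i)$ for its coefficient on $\rho'$. **Fences.** Fix a community in $K^{\mathbf c}I$ for every $\mathbf c\in\mathbb N^n$, with stake sets $S^{\mathbf c}_i$ and shrubberies $T^{\mathbf c}_i$. Let $\mathbf a\prec\mathbf b$ in $\mathbb N^n$ (that is, $\mathbf a\le\mathbf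 b$ coordinatewise and $\mathbf a\ne\mathbf b$), and let $\Lambda(\mathbf a,\mathbf b)$ be the set of saturated decreasing lattice paths $\lambda:\mathbf b=\mathbf b_0,\mathbf b_1,\dots,\mathbf b_\ell=\mathbf a$, whose steps $\lambda_j=\mathbf b_{j-1}-\mathbf b_j$ are standard basis vectors. Let $i\ge 0$, $\tau\in K^{\mathbf b}_iI$ and $\sigma\in K^{\mathbf a}_{i-1}I$. A *chain-link fence* $\phi$ from $\tau$ to $\sigma$ along $\lambda$, subordinate to the given communities, consists of faces $\tau_j\in K_i^{\mathbf b_j}I$ $(0\le j\le\ell-1)$ and $\sigma_j\in K_{i-1}^{\mathbf b_j}I$ $(1\le j\le \ell)$ such that * $c_\tau(\tau_0,S_i^{\mathbf b})\neq0$; * $\sigma_j=\tau_{j-1}-\lambda_j$ is a facet of $\tau_{j-1}$ for $1\le j\le\ell$; * $\sigma_j\in S_{i-1}^{\mathbf b_j}$ and $c_{\sigma_j}(\tau_j,ST_i^{\mathbf b_j})\ne0$ for $1\le j\le\ell-1$; * $c_{\sigma_\ell}(\sigma,T_{i-1}^{\mathbf a})\ne0$. Its *simple weight* is $$w_\phi^\Bbbk=c_\tau(\tau_0,S_i^{\mathbf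 b})\cdot\prod_{j=1}^{\ell-1}c_{\sigma_j}(\tau_j,ST_i^{\mathbf b_j})\cdot\prod_{j=1}^{\ell}(-1)^{\sigma_j\subset\tau_{j-1}}\cdot c_{\sigma_\ell}(\sigma,T_{i-1}^{\mathbf a}).$$ The *sylvan homomorphism* $D=D^{\mathbf a\mathbf b}:\widetilde C_iK^{\mathbf b}I\to\widetilde C_{i-1}K^{\mathbf a}I$ is given by the matrix whose entry $D_{\sigma\tau}$ is the sum of the simple weights $w^\Bbbk_\phi$ of all these fences from $\tau$ to $\sigma$ along all $\lambda\in\Lambda(\mathbf a,\mathbf b)$. **Claim.** For all $\mathbf a\prec\mathbf b$ and $i\ge0$, the sylvan homomorphism $D^{\mathbf a\mathbf b}$ maps $\widetilde Z_iK^{\mathbf b}I$ into $\widetilde Z_{i-1}K^{\mathbf a}I$ and vanishes on $\widetilde B_iK^{\mathbf b}I$; hence it induces a well-defined *sylvan homology morphism* $\widetilde H_iK^{\mathbf b}I\to\widetilde H_{i-1}K^{\mathbf a}I$. The induced homomorphisms of $\mathbb N^n$-graded free $\Bbbk[\mathbf x]$-modules $$\widetilde H_iK^{\mathbf b}I\otimes_\Bbbk\Bbbk[\mathbf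 x](-\mathbf b)\to\widetilde H_{i-1}K^{\mathbf a}I\otimes_\Bbbk\Bbbk[\mathbf x](-\mathbf a)\qquad(\mathbf a\prec\mathbf b)$$ (the homology morphism times $\mathbf x^{\mathbf b-\mathbf a}$) are the components of the differentials of a minimal $\mathbb N^n$-graded free resolution of $I$ whose module in homological stage $i$ is $\bigoplus_{\mathbf b\in\mathbb N^n}\widetilde H_{i-1}K^{\mathbf b}I\otimes_\Bbbk\Bbbk[\mathbf x](-\mathbf b)$. -/

import Mathlib

open scoped TensorProduct DirectSum

namespace Sylvan

/-! ### Chains on subcomplexes of the simplex with vertex set `{0, …, n - 1}`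

A simplicial complex is a lower set of finite sets.  It may be void, and `∅` is a face of every
complex that is not void.  Faces and chains are indexed by the cardinality `k` of the faces, so
index `k` stands for dimension `k - 1`. -/

section Chains

variable (𝕜 : Type*) [Field 𝕜] {n : ℕ}

/-- All chains on the full simplex; the faces form the standard basis. -/
abbrev Chain (n : ℕ) : Type _ := Finset (Fin n) → 𝕜

/-- The span of a set `T` of faces: the chains whose coefficients outside of `T` vanish. -/
def facesSpan (T : Set (Finset (Fin n))) : Submodule 𝕜 (Chain 𝕜 n) where
  carrier := {c | ∀ τ, τ ∉ T → c τ = 0}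
  add_mem' hc hc' τ hτ := by simp [hc τ hτ, hc' τ hτ]
  zero_mem' _ _ := rfl
  smul_mem' t c hc τ hτ := by simp [hc τ hτ]

variable {𝕜} in
theorem single_mem_facesSpan {T : Set (Finset (Fin n))} {σ : Finset (Fin n)} (hσ : σ ∈ T) :
    (Pi.single σ 1 : Chain 𝕜 n) ∈ facesSpan 𝕜 T :=
  fun _ hτ => Pi.single_eq_of_ne (fun h => hτ (by rwa [h])) 1

variable {𝕜} in
theorem facesSpan_mono {T T' : Set (Finset (Fin n))} (h : T ⊆ T') :
    facesSpan 𝕜 T ≤ facesSpan 𝕜 T' :=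
  fun _ hc τ hτ => hc τ fun h' => hτ (h h')

/-- The sign of the facet `τ \ {v}` in the boundary of `τ`: `(-1) ^ j` if `v` is the `j`-th
vertex of `τ` in increasing order, starting with `j = 0`. -/
def facetSign (v : Fin n) (τ : Finset (Fin n)) : 𝕜 := (-1) ^ (τ.filter (· < v)).card

/-- The reduced simplicial boundary map. -/
noncomputable def boundary : Chain 𝕜 n →ₗ[𝕜] Chain 𝕜 n :=
  Fintype.linearCombination 𝕜 fun τ : Finset (Fin n) =>
    ∑ v ∈ τ, facetSign 𝕜 v τ • (Pi.single (τ.erase v) 1 : Chain 𝕜 n)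

/-- The faces of `K` with `k` vertices, that is, of dimension `k - 1`. -/
def faces (K : LowerSet (Finset (Fin n))) (k : ℕ) : Set (Finset (Fin n)) :=
  {τ | τ ∈ K ∧ τ.card = k}

/-- The reduced chains of `K` in dimension `k - 1`. -/
noncomputable def chains (K : LowerSet (Finset (Fin n))) (k : ℕ) : Submodule 𝕜 (Chain 𝕜 n) :=
  facesSpan 𝕜 (faces K k)

/-- The reduced cycles of `K` in dimension `k - 1`. -/
noncomputable def cycles (K : LowerSet (Finset (Fin n))) (k : ℕ) : Submodule 𝕜 (Chain 𝕜 n) :=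
  chains 𝕜 K k ⊓ LinearMap.ker (boundary 𝕜)

/-- The reduced boundaries of `K` in dimension `k - 1`. -/
noncomputable def boundaries (K : LowerSet (Finset (Fin n))) (k : ℕ) :
    Submodule 𝕜 (Chain 𝕜 n) :=
  (chains 𝕜 K (k + 1)).map (boundary 𝕜)

variable {𝕜} in
theorem boundaries_le_chains (K : LowerSet (Finset (Fin n))) (k : ℕ) :
    boundaries 𝕜 K k ≤ chains 𝕜 K k := by
  rintro _ ⟨c, hc, rfl⟩
  rw [boundary, Fintype.linearCombination_apply]
  refine Submodule.sum_mem _ fun τ _ => ?_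
  by_cases hτ : τ ∈ faces K (k + 1)
  · refine Submodule.smul_mem _ _ (Submodule.sum_mem _ fun v hv => Submodule.smul_mem _ _ ?_)
    refine single_mem_facesSpan ⟨K.lower (Finset.erase_subset v τ) hτ.1, ?_⟩
    rw [Finset.card_erase_of_mem hv, hτ.2, Nat.add_sub_cancel]
  · rw [hc τ hτ, zero_smul]
    exact Submodule.zero_mem _

/-- The reduced homology of `K` in dimension `k - 1`. -/
abbrev Homology (K : LowerSet (Finset (Fin n))) (k : ℕ) : Type _ :=
  cycles 𝕜 K k ⧸ (boundaries 𝕜 K k).submoduleOf (cycles 𝕜 K k)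

/-- `T` is a shrubbery of `K` in dimension `k - 1`: a set of `(k - 1)`-faces such that the boundary
map is an isomorphism from the span of `T` to the boundary of the whole chain space. -/
def IsShrubbery (K : LowerSet (Finset (Fin n))) (k : ℕ) (T : Set (Finset (Fin n))) : Prop :=
  T ⊆ faces K k ∧
    Set.BijOn (boundary 𝕜 (n := n)) (facesSpan 𝕜 T)
      ((chains 𝕜 K k).map (boundary 𝕜))

/-- `S` is a stake set of `K` in dimension `k - 1`: a set of `(k - 1)`-faces such that restricting
coefficients to `S` is an isomorphism from the space of `(k - 1)`-boundaries to `𝕜 ^ S`. -/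
def IsStakeSet (K : LowerSet (Finset (Fin n))) (k : ℕ) (S : Set (Finset (Fin n))) : Prop :=
  S ⊆ faces K k ∧
    Function.Bijective fun (β : boundaries 𝕜 K k) (σ : S) => (β : Chain 𝕜 n) σ

/-- A community in `K`: in every dimension `i ≥ 0` a hedge, consisting of a stake set
`stakes i` in dimension `i - 1` and a shrubbery `shrubs (i + 1)` in dimension `i`, such that in each
dimension the shrubbery and the stake set are disjoint.  For uniformity the shrubbery `shrubs 0` in
dimension `-1` is part of the data; it is forced to be the empty set of faces. -/
structure Community (K : LowerSet (Finset (Fin n))) where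
  stakes : ℕ → Set (Finset (Fin n))
  shrubs : ℕ → Set (Finset (Fin n))
  isStakeSet : ∀ k, IsStakeSet 𝕜 K k (stakes k)
  isShrubbery : ∀ k, IsShrubbery 𝕜 K k (shrubs k)
  disjoint : ∀ k, Disjoint (shrubs k) (stakes k)

end Chains

section Links

variable {𝕜 : Type*} [Field 𝕜] {n : ℕ}

/-- The unique chain with the property `P` (and `0` if there is no such unique chain). -/
noncomputable def theChain (P : Chain 𝕜 n → Prop) : Chain 𝕜 n :=
  open Classical in if h : ∃! c, P c then h.choose else 0

theorem theChain_spec {P : Chain 𝕜 n → Prop} (h : ∃! c, P c) : P (theChain P) := by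
  classical
  rw [theChain, dif_pos h]
  exact h.choose_spec.1

variable {K : LowerSet (Finset (Fin n))} (𝒞 : Community 𝕜 K)

/-- `z` is the circuit of the `(k - 1)`-face `σ`: a cycle that differs from `σ` by a chain on the
shrubbery in dimension `k - 1`. -/
def IsCircuit (k : ℕ) (σ : Finset (Fin n)) (z : Chain 𝕜 n) : Prop :=
  z ∈ cycles 𝕜 K k ∧ Pi.single σ 1 - z ∈ facesSpan 𝕜 (𝒞.shrubs k)

/-- `s` is the shrub of the stake `σ` of dimension `k - 1`: a chain on the shrubbery in dimension
`k` whose boundary has coefficient `1` on `σ` and `0` on all other stakes. -/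
def IsShrub (k : ℕ) (σ : Finset (Fin n)) (s : Chain 𝕜 n) : Prop :=
  s ∈ facesSpan 𝕜 (𝒞.shrubs (k + 1)) ∧
    boundary 𝕜 s σ = 1 ∧ ∀ σ' ∈ 𝒞.stakes k, σ' ≠ σ → boundary 𝕜 s σ' = 0

/-- `r` is the hedge rim of the `(k - 1)`-face `ρ`: a chain on the non-stakes of dimension
`k - 1` that differs from `ρ` by a boundary. -/
def IsHedgeRim (k : ℕ) (ρ : Finset (Fin n)) (r : Chain 𝕜 n) : Prop :=
  r ∈ facesSpan 𝕜 (faces K k \ 𝒞.stakes k) ∧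
    Pi.single ρ 1 - r ∈ boundaries 𝕜 K k

theorem existsUnique_isCircuit {k : ℕ} {σ : Finset (Fin n)} (hσ : σ ∈ faces K k) :
    ∃! z, IsCircuit 𝒞 k σ z := by
  obtain ⟨hT, hmap, hinj, hsurj⟩ := 𝒞.isShrubbery k
  have hσc : (Pi.single σ 1 : Chain 𝕜 n) ∈ chains 𝕜 K k := single_mem_facesSpan hσ
  obtain ⟨t, ht, hts⟩ := hsurj ⟨_, hσc, rfl⟩
  refine ⟨Pi.single σ 1 - t, ⟨⟨?_, ?_⟩, ?_⟩, ?_⟩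
  · exact Submodule.sub_mem _ hσc (facesSpan_mono hT ht)
  · simp [hts]
  · simpa using ht
  · rintro z ⟨⟨-, hz⟩, hzt⟩
    have : Pi.single σ 1 - z = t := hinj hzt ht (by
      rw [map_sub, hts, LinearMap.mem_ker.1 hz, sub_zero])
    rw [← this, sub_sub_cancel]

theorem existsUnique_isShrub {k : ℕ} {σ : Finset (Fin n)} (hσ : σ ∈ 𝒞.stakes k) :
    ∃! s, IsShrub 𝒞 k σ s := by
  classical
  obtain ⟨hT, hmap, hinj, hsurj⟩ := 𝒞.isShrubbery (k + 1)
  obtain ⟨hS, hinj', hsurj'⟩ := 𝒞.isStakeSet k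
  obtain ⟨⟨β, hβ⟩, hβσ⟩ := hsurj' fun σ' => if (σ' : Finset (Fin n)) = σ then 1 else 0
  obtain ⟨s, hs, rfl⟩ := hsurj hβ
  refine ⟨s, ⟨hs, by simpa using congrFun hβσ ⟨σ, hσ⟩, fun σ' h' hne => ?_⟩, ?_⟩
  · simpa [hne] using congrFun hβσ ⟨σ', h'⟩
  · rintro s' ⟨hs', h1, h0⟩
    refine hinj hs' hs ?_
    have := @hinj' ⟨_, hmap hs'⟩ ⟨_, hβ⟩ (by
      rw [hβσ]
      funext ⟨σ', h'⟩
      by_cases h : σ' = σ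
      · subst h; simpa using h1
      · simpa [h] using h0 σ' h' h)
    exact congrArg Subtype.val this

theorem existsUnique_isHedgeRim {k : ℕ} {ρ : Finset (Fin n)} (hρ : ρ ∈ faces K k) :
    ∃! r, IsHedgeRim 𝒞 k ρ r := by
  obtain ⟨hS, hinj, hsurj⟩ := 𝒞.isStakeSet k
  obtain ⟨⟨β, hβ⟩, hβσ⟩ := hsurj fun σ' => ((Pi.single ρ 1 : Chain 𝕜 n)) σ'
  have hρc : (Pi.single ρ 1 : Chain 𝕜 n) ∈ chains 𝕜 K k := single_mem_facesSpan hρ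
  refine ⟨Pi.single ρ 1 - β, ⟨?_, by simpa using hβ⟩, ?_⟩
  · intro τ hτ
    by_cases hτS : τ ∈ 𝒞.stakes k
    · have := congrFun hβσ ⟨τ, hτS⟩
      simp only at this
      simp [this]
    · have hτK : τ ∉ faces K k := fun h => hτ ⟨h, hτS⟩
      exact (Submodule.sub_mem _ hρc (boundaries_le_chains K k hβ)) τ hτK
  · rintro r ⟨hr, hrB⟩
    have hβr := @hinj ⟨_, hrB⟩ ⟨_, hβ⟩ (by
      rw [hβσ]
      funext ⟨σ', h'⟩
      have : r σ' = 0 := hr σ' fun h => h.2 h'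
      simp [this])
    have hβr' : Pi.single ρ 1 - r = β := congrArg Subtype.val hβr
    rw [← hβr', sub_sub_cancel]

/-- The coefficient of `σ'` in the circuit of the `(k - 1)`-face `σ`. -/
noncomputable def circuitCoeff (k : ℕ) (σ σ' : Finset (Fin n)) : 𝕜 :=
  theChain (IsCircuit 𝒞 k σ) σ'

/-- The coefficient of `τ` in the shrub of the `(k - 1)`-stake `σ`. -/
noncomputable def shrubCoeff (k : ℕ) (σ τ : Finset (Fin n)) : 𝕜 :=
  theChain (IsShrub 𝒞 k σ) τ

/-- The coefficient of `ρ'` in the hedge rim of the `(k - 1)`-face `ρ`. -/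
noncomputable def rimCoeff (k : ℕ) (ρ ρ' : Finset (Fin n)) : 𝕜 :=
  theChain (IsHedgeRim 𝒞 k ρ) ρ'

end Links

section Koszul

variable {𝕜 : Type*} [Field 𝕜] {n : ℕ}

/-- A monomial ideal: an ideal generated by monomials. -/
def IsMonomialIdeal (I : Ideal (MvPolynomial (Fin n) 𝕜)) : Prop :=
  ∃ A : Set (Fin n →₀ ℕ), I = Ideal.span ((fun e => MvPolynomial.monomial e (1 : 𝕜)) '' A)

/-- The characteristic vector of a finite set. -/
noncomputable def charVec (τ : Finset (Fin n)) : Fin n →₀ ℕ := ∑ v ∈ τ, Finsupp.single v 1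

theorem charVec_mono {σ τ : Finset (Fin n)} (h : σ ⊆ τ) : charVec σ ≤ charVec τ :=
  Finset.sum_le_sum_of_subset h

/-- The (upper) Koszul simplicial complex of `I` in degree `b`: all `τ` such that
`x ^ (b - τ)` is a monomial that lies in `I`. -/
noncomputable def koszul (I : Ideal (MvPolynomial (Fin n) 𝕜)) (b : Fin n →₀ ℕ) :
    LowerSet (Finset (Fin n)) where
  carrier := {τ | charVec τ ≤ b ∧ MvPolynomial.monomial (b - charVec τ) (1 : 𝕜) ∈ I}
  lower' := by
    rintro τ σ hστ ⟨hb, hI⟩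
    have h := charVec_mono hστ
    refine ⟨h.trans hb, ?_⟩
    have : b - charVec σ = (charVec τ - charVec σ) + (b - charVec τ) := by
      ext v
      have h1 := h v
      have h2 := hb v
      simp only [Finsupp.coe_tsub, Pi.sub_apply, Finsupp.coe_add, Pi.add_apply]
      omega
    rw [this, ← one_mul (1 : 𝕜), ← MvPolynomial.monomial_mul]
    exact I.mul_mem_left _ hI

end Koszul

/-! ### Lattice paths and chain-link fences

A saturated decreasing lattice path of length `m + 1` from `b` to `a` is given by its sequence of
steps; `p j` is the index of the coordinate direction of the `(j + 1)`-st step. -/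

section Fences

variable {𝕜 : Type*} [Field 𝕜] {n : ℕ}

/-- The saturated decreasing lattice paths of length `m + 1` from `b` to `a`. -/
noncomputable def latticePaths (m : ℕ) (a b : Fin n →₀ ℕ) : Finset (Fin (m + 1) → Fin n) :=
  Finset.univ.filter fun p => a + ∑ j, Finsupp.single (p j) 1 = b

/-- The `j`-th lattice point on the path that starts in `b` and has the steps `p`. -/
noncomputable def node {m : ℕ} (b : Fin n →₀ ℕ) (p : Fin (m + 1) → Fin n) (j : ℕ) : Fin n →₀ ℕ :=
  b - ∑ i with i.val < j, Finsupp.single (p i) 1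

/-- The inner vertices of a fence along a path of length `ℓ = m + 1`:
`upper j` is the `i`-simplex `τ_j` for `0 ≤ j ≤ ℓ - 1`, and
`lower j` is the `(i - 1)`-simplex `σ_{j + 1}`, again for `0 ≤ j ≤ ℓ - 1`. -/
abbrev FenceData (m n : ℕ) : Type :=
  (Fin (m + 1) → Finset (Fin n)) × (Fin (m + 1) → Finset (Fin n))

/-- The simplices `τ_0, …, τ_{ℓ - 1}`. -/
abbrev FenceData.upper {m n : ℕ} (φ : FenceData m n) : Fin (m + 1) → Finset (Fin n) := φ.1

/-- The simplices `σ_1, …, σ_ℓ`. -/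
abbrev FenceData.lower {m n : ℕ} (φ : FenceData m n) : Fin (m + 1) → Finset (Fin n) := φ.2

variable {I : Ideal (MvPolynomial (Fin n) 𝕜)} (𝒞 : ∀ c, Community 𝕜 (koszul I c))

/-- `φ` is a chain-link fence along the path with steps `p` from `b` to `a`, from the
`i`-simplex `τ` to the `(i - 1)`-simplex `σ`, subordinate to the hedgerow cut out of the given
communities.  Here `i` is a dimension, so `i`-simplices have `i + 1` vertices. -/
structure IsFence {m : ℕ} (i : ℕ) (a b : Fin n →₀ ℕ) (p : Fin (m + 1) → Fin n)
    (σ τ : Finset (Fin n)) (φ : FenceData m n) : Prop where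
  initial_mem : τ ∈ faces (koszul I b) (i + 1)
  terminal_mem : σ ∈ faces (koszul I a) i
  upper_mem : ∀ j : Fin (m + 1), φ.upper j ∈ faces (koszul I (node b p j)) (i + 1)
  lower_mem : ∀ j : Fin (m + 1), φ.lower j ∈ faces (koszul I (node b p (j + 1))) i
  /-- `τ` is boundary-linked to `τ_0`. -/
  boundary_link : rimCoeff (𝒞 b) (i + 1) τ (φ.upper 0) ≠ 0
  /-- `σ_j` is the facet `τ_{j - 1} - λ_j` of `τ_{j - 1}`. -/
  facet : ∀ j : Fin (m + 1), p j ∈ φ.upper j ∧ φ.lower j = (φ.upper j).erase (p j)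
  /-- At each interior vertex of the path, `σ_j` is a stake. -/
  stake : ∀ j : Fin m, φ.lower j.castSucc ∈ (𝒞 (node b p (j + 1))).stakes i
  /-- At each interior vertex of the path, the stake `σ_j` is chain-linked to `τ_j`. -/
  chain_link : ∀ j : Fin m,
    shrubCoeff (𝒞 (node b p (j + 1))) i (φ.lower j.castSucc) (φ.upper j.succ) ≠ 0
  /-- `σ_ℓ` is cycle-linked to `σ`. -/
  cycle_link : circuitCoeff (𝒞 a) i (φ.lower (Fin.last m)) σ ≠ 0

/-- The simple weight of a fence: the product of the simple weights of its edges. -/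
noncomputable def simpleWeight {m : ℕ} (i : ℕ) (a b : Fin n →₀ ℕ) (p : Fin (m + 1) → Fin n)
    (σ τ : Finset (Fin n)) (φ : FenceData m n) : 𝕜 :=
  rimCoeff (𝒞 b) (i + 1) τ (φ.upper 0) *
    (∏ j : Fin m,
      shrubCoeff (𝒞 (node b p (j + 1))) i (φ.lower j.castSucc) (φ.upper j.succ)) *
    (∏ j : Fin (m + 1), facetSign 𝕜 (p j) (φ.upper j)) *
    circuitCoeff (𝒞 a) i (φ.lower (Fin.last m)) σ

open Classical in
/-- The entry `D_{σ τ}` of the sylvan matrix: the sum, over all saturated decreasing lattice paths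
from `b` to `a`, of the simple weights of all fences from `τ` to `σ` along the path that are
subordinate to the given hedgerow.  For `a < b` all such paths have length `|b| - |a| ≥ 1`. -/
noncomputable def sylvanEntry (i : ℕ) (a b : Fin n →₀ ℕ) (σ τ : Finset (Fin n)) : 𝕜 :=
  ∑ p ∈ latticePaths (b.degree - a.degree - 1) a b,
    ∑ φ : FenceData (b.degree - a.degree - 1) n with IsFence 𝒞 i a b p σ τ φ,
      simpleWeight 𝒞 i a b p σ τ φ

/-- The sylvan homomorphism from the `i`-chains of `koszul I b` to the `(i - 1)`-chains of
`koszul I a`, with matrix `sylvanEntry`.  (All entries outside of these faces vanish.) -/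
noncomputable def sylvanHom (i : ℕ) (a b : Fin n →₀ ℕ) : Chain 𝕜 n →ₗ[𝕜] Chain 𝕜 n :=
  Fintype.linearCombination 𝕜 fun τ : Finset (Fin n) =>
    ∑ σ : Finset (Fin n), sylvanEntry 𝒞 i a b σ τ • (Pi.single σ 1 : Chain 𝕜 n)

/-- The sylvan homomorphism maps cycles to cycles and vanishes on boundaries. -/
def InducesOnHomology (i : ℕ) (a b : Fin n →₀ ℕ) : Prop :=
  (∀ z ∈ cycles 𝕜 (koszul I b) (i + 1), sylvanHom 𝒞 i a b z ∈ cycles 𝕜 (koszul I a) i) ∧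
    ∀ z ∈ boundaries 𝕜 (koszul I b) (i + 1), sylvanHom 𝒞 i a b z = 0

/-- The sylvan homology morphism. -/
noncomputable def sylvanHomology (i : ℕ) (a b : Fin n →₀ ℕ) (h : InducesOnHomology 𝒞 i a b) :
    Homology 𝕜 (koszul I b) (i + 1) →ₗ[𝕜] Homology 𝕜 (koszul I a) i :=
  Submodule.mapQ _ _ ((sylvanHom 𝒞 i a b).restrict h.1) (by
    intro z hz
    have h0 : (sylvanHom 𝒞 i a b).restrict h.1 z = 0 := Subtype.ext (h.2 z hz)
    rw [Submodule.mem_comap, h0]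
    exact Submodule.zero_mem _)

/-! ### The complex of free modules -/

variable (I) in
/-- The free module in homological stage `i`: the direct sum over all degrees `b` of
`H ⊗ 𝕜[x](-b)`, where `H` is the reduced homology of `koszul I b` in dimension `i - 1`. -/
abbrev SylvanModule (i : ℕ) : Type _ :=
  ⨁ b : Fin n →₀ ℕ, MvPolynomial (Fin n) 𝕜 ⊗[𝕜] Homology 𝕜 (koszul I b) i

variable (I) in
/-- The component of `SylvanModule I i` in degree `c`; the element `x ^ e ⊗ h` of the summand
indexed by `b` has degree `e + b`. -/
noncomputable def sylvanPiece (i : ℕ) (c : Fin n →₀ ℕ) : Submodule 𝕜 (SylvanModule I i) :=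
  Submodule.span 𝕜 {x | ∃ (e b : Fin n →₀ ℕ) (h : Homology 𝕜 (koszul I b) i), e + b = c ∧
    x = DirectSum.lof (MvPolynomial (Fin n) 𝕜) (Fin n →₀ ℕ)
      (fun b => MvPolynomial (Fin n) 𝕜 ⊗[𝕜] Homology 𝕜 (koszul I b) i) b
      (MvPolynomial.monomial e 1 ⊗ₜ h)}

/-- The homomorphism from stage `i + 1` to stage `i` whose component from the summand of `b` to the
summand of `a < b` is `x ^ (b - a)` times the sylvan homology morphism. -/
noncomputable def sylvanDifferential
    (h : ∀ a b : Fin n →₀ ℕ, a < b → ∀ i, InducesOnHomology 𝒞 i a b) (i : ℕ) :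
    SylvanModule I (i + 1) →ₗ[MvPolynomial (Fin n) 𝕜] SylvanModule I i :=
  DirectSum.toModule (MvPolynomial (Fin n) 𝕜) (Fin n →₀ ℕ) (SylvanModule I i) fun b =>
    ∑ a ∈ (Finset.Iio b).attach,
      DirectSum.lof (MvPolynomial (Fin n) 𝕜) (Fin n →₀ ℕ)
        (fun a => MvPolynomial (Fin n) 𝕜 ⊗[𝕜] Homology 𝕜 (koszul I a) i) a.1 ∘ₗ
        ((MvPolynomial.monomial (b - a.1) (1 : 𝕜)) •
          (sylvanHomology 𝒞 i a.1 b (h a.1 b (Finset.mem_Iio.1 a.2) i)).baseChange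
            (MvPolynomial (Fin n) 𝕜))

end Fences

/-- The homomorphisms `d` make the modules `F 0, F 1, F 2, …` with the gradings `𝒜` a minimal
`ℕ ^ n`-graded free resolution of the ideal `I`. -/
structure IsMinimalFreeResolution {𝕜 : Type*} [Field 𝕜] {n : ℕ}
    (I : Ideal (MvPolynomial (Fin n) 𝕜)) (F : ℕ → Type*) [∀ i, AddCommGroup (F i)]
    [∀ i, Module (MvPolynomial (Fin n) 𝕜) (F i)] [∀ i, Module 𝕜 (F i)]
    [∀ i, IsScalarTower 𝕜 (MvPolynomial (Fin n) 𝕜) (F i)]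
    (𝒜 : ∀ i, (Fin n →₀ ℕ) → Submodule 𝕜 (F i))
    (d : ∀ i, F (i + 1) →ₗ[MvPolynomial (Fin n) 𝕜] F i) : Prop where
  /-- Each `F i` is a graded free module of finite rank. -/
  graded_free : ∀ i, ∃ (r : ℕ) (B : Module.Basis (Fin r) (MvPolynomial (Fin n) 𝕜) (F i))
    (deg : Fin r → (Fin n →₀ ℕ)), ∀ c, 𝒜 i c = Submodule.span 𝕜
      {x | ∃ (e : Fin n →₀ ℕ) (j : Fin r), e + deg j = c ∧
        x = MvPolynomial.monomial e (1 : 𝕜) • B j}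
  /-- The differentials preserve degrees. -/
  homogeneous : ∀ i c, ∀ x ∈ 𝒜 (i + 1) c, d i x ∈ 𝒜 i c
  /-- The complex is exact in all positive homological stages. -/
  exact : ∀ i, Function.Exact (d (i + 1)) (d i)
  /-- The cokernel of the last map is isomorphic to `I`, as a graded module. -/
  augmentation : ∃ ε : F 0 →ₗ[MvPolynomial (Fin n) 𝕜] I,
    Function.Surjective ε ∧ Function.Exact (d 0) ε ∧
      ∀ c, ∀ x ∈ 𝒜 0 c, ∃ t : 𝕜, (ε x : MvPolynomial (Fin n) 𝕜) = MvPolynomial.monomial c t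
  /-- Minimality: the differentials vanish modulo the maximal ideal `(x_1, …, x_n)`. -/
  minimal : ∀ i, LinearMap.range (d i) ≤
    Ideal.span (Set.range (MvPolynomial.X : Fin n → MvPolynomial (Fin n) 𝕜)) •
      (⊤ : Submodule (MvPolynomial (Fin n) 𝕜) (F i))

end Sylvan

/-! Let h send each stake to its shrub and every other face to 0. On the chains of one complex K^b
it satisfies ∂h∂ = ∂, h∂h = h and, because the shrubbery and the stake set of a given dimension are
disjoint, h² = 0. So h splits the chain complex: hedge rims are the values of 1 - ∂h, circuits those
of 1 - h∂, and π = 1 - ∂h - h∂ projects onto the harmonic chains, those killed by ∂ and h, which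
represent homology.

The resolution comes from a larger one, the Koszul complex of the elements x_v ⊗ 1 - 1 ⊗ x_v on I ⊗
𝕜[x]. Its strand in degree c is the sum of the chains on K^b over all b ≤ c, a face τ of K^b
standing for x^(b-τ) ⊗ e_τ ⊗ x^(c-b). The differential is ∂ - p, where p (`descent`) removes a
vertex v and passes from b to b - e_v. Adding a vertex w while raising the degree by e_w is a
homotopy from the identity to a translation that pushes cycles towards degree c and the face ∅,
where only the augmentation is left (`koszulD_ascent_add`, `strand_exact`).

Now view p as a perturbation of ∂. Since hp lowers degrees, 1 - hp is invertible on the strand with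
inverse A = Σ (hp)^m. Homological perturbation theory transfers ∂ - p to -πpA on harmonic families
and keeps exactness (`perturbed_inclusion`, `perturbed_projection`, `perturbed_retraction`,
`transfer_exact`); the sign is immaterial.

A term p(hp)^m chooses a lattice path with m + 1 steps and alternately removes the vertex of a step
and replaces stakes by shrubs; its matrix expansion is the sum over fences (`sum_simpleWeight`,
`descent_resolvent_single`). Hence the sylvan homomorphism is (1 - h∂)pA(1 - ∂h), and on harmonic
representatives it induces πpA. As `strandMap` identifies the degree c part of a sylvan module with
the harmonic families in the strand, exactness follows degree by degree
(`strandMap_sylvanDifferential`). Minimality holds because every component strictly decreases the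
degree b, and ranks are finite because K^b is a cone unless b lies below the join of the generating
exponents. -/

namespace Sylvan

/-! ### Removing and adding a vertex -/

section Vertices

variable {𝕜 : Type*} [Field 𝕜] {n : ℕ}

/-- The linear map that sends a face `τ` to `facetSign v τ • (τ \ {v})` if `v ∈ τ`, and to `0`
otherwise. -/
def removeVertex (v : Fin n) : Chain 𝕜 n →ₗ[𝕜] Chain 𝕜 n where
  toFun x σ := if v ∈ σ then 0 else facetSign 𝕜 v σ * x (insert v σ)
  map_add' x y := by ext σ; by_cases h : v ∈ σ <;> simp [h, mul_add]
  map_smul' t x := by ext σ; by_cases h : v ∈ σ <;> simp [h, mul_left_comm]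

/-- The linear map that sends a face `τ` to `facetSign v τ • (τ ∪ {v})` if `v ∉ τ`, and to `0`
otherwise. -/
def addVertex (v : Fin n) : Chain 𝕜 n →ₗ[𝕜] Chain 𝕜 n where
  toFun x τ := if v ∈ τ then facetSign 𝕜 v τ * x (τ.erase v) else 0
  map_add' x y := by ext σ; by_cases h : v ∈ σ <;> simp [h, mul_add]
  map_smul' t x := by ext σ; by_cases h : v ∈ σ <;> simp [h, mul_left_comm]

theorem removeVertex_apply (v : Fin n) (x : Chain 𝕜 n) (σ : Finset (Fin n)) :
    removeVertex v x σ = if v ∈ σ then 0 else facetSign 𝕜 v σ * x (insert v σ) := rfl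

theorem addVertex_apply (v : Fin n) (x : Chain 𝕜 n) (τ : Finset (Fin n)) :
    addVertex v x τ = if v ∈ τ then facetSign 𝕜 v τ * x (τ.erase v) else 0 := rfl

theorem facetSign_mul_self (v : Fin n) (τ : Finset (Fin n)) :
    facetSign 𝕜 v τ * facetSign 𝕜 v τ = 1 := by
  rw [facetSign, ← pow_add, ← two_mul, pow_mul]
  simp

theorem facetSign_insert_self (v : Fin n) (τ : Finset (Fin n)) :
    facetSign 𝕜 v (insert v τ) = facetSign 𝕜 v τ := by
  simp [facetSign, Finset.filter_insert]

theorem facetSign_erase_self (v : Fin n) (τ : Finset (Fin n)) :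
    facetSign 𝕜 v (τ.erase v) = facetSign 𝕜 v τ := by
  rw [← facetSign_insert_self v (τ.erase v)]
  by_cases h : v ∈ τ
  · rw [Finset.insert_erase h]
  · rw [Finset.erase_eq_of_notMem h, facetSign_insert_self]

theorem facetSign_insert {v w : Fin n} {τ : Finset (Fin n)} (hw : w ∉ τ) :
    facetSign 𝕜 v (insert w τ) = (if w < v then -1 else 1) * facetSign 𝕜 v τ := by
  by_cases h : w < v
  · rw [facetSign, Finset.filter_insert, if_pos h, Finset.card_insert_of_notMem (by simp [hw]),
      pow_succ, if_pos h, facetSign, mul_comm]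
  · rw [facetSign, Finset.filter_insert, if_neg h, if_neg h, one_mul, facetSign]

/-- For `v ≠ w`, exactly one of the two signs changes when the other vertex is inserted, namely the
sign of the larger vertex. -/
theorem removeVertex_removeVertex (v w : Fin n) (x : Chain 𝕜 n) :
    removeVertex v (removeVertex w x) + removeVertex w (removeVertex v x) = 0 := by
  ext σ
  simp only [Pi.add_apply, removeVertex_apply, Finset.mem_insert, Pi.zero_apply]
  by_cases hv : v ∈ σ
  · simp [hv]
  by_cases hw : w ∈ σ
  · simp [hw]
  by_cases hvw : v = w
  · simp [hvw]
  rw [if_neg hv, if_neg hw, if_neg (by tauto), if_neg (by tauto), facetSign_insert hv,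
    facetSign_insert hw, Finset.insert_comm]
  rcases lt_or_gt_of_ne hvw with h | h
  · rw [if_pos h, if_neg h.not_gt]; ring
  · rw [if_pos h, if_neg h.not_gt]; ring

theorem removeVertex_removeVertex_self (v : Fin n) (x : Chain 𝕜 n) :
    removeVertex v (removeVertex v x) = 0 := by
  ext σ
  simp [removeVertex_apply]

/-- This is the exterior algebra relation between contraction by `v` and multiplication by `w`. For
`v = w` the two compositions are instead complementary projections, as the next two lemmas show. -/
theorem removeVertex_addVertex {v w : Fin n} (hvw : v ≠ w) (x : Chain 𝕜 n) :
    removeVertex v (addVertex w x) + addVertex w (removeVertex v x) = 0 := by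
  ext σ
  simp only [Pi.add_apply, removeVertex_apply, addVertex_apply, Finset.mem_insert, Pi.zero_apply,
    Finset.mem_erase]
  by_cases hv : v ∈ σ
  · simp [hv, hvw]
  by_cases hw : w ∈ σ
  · rw [if_neg hv, if_pos hw, if_pos (Or.inr hw), if_neg (not_and_of_not_right _ hv)]
    obtain ⟨ρ, hρ, rfl⟩ : ∃ ρ, w ∉ ρ ∧ insert w ρ = σ :=
      ⟨σ.erase w, by simp, Finset.insert_erase hw⟩
    have hvρ : v ∉ ρ := fun h => hv (Finset.mem_insert_of_mem h)
    rw [Finset.insert_comm, facetSign_insert hρ, Finset.erase_insert (by simp [hρ, Ne.symm hvw]),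
      Finset.erase_insert hρ, facetSign_insert_self, facetSign_insert_self,
      facetSign_insert hvρ]
    rcases lt_or_gt_of_ne hvw with h | h
    · rw [if_pos h, if_neg h.not_gt]; ring
    · rw [if_pos h, if_neg h.not_gt]; ring
  · simp [hw, Ne.symm hvw]

theorem removeVertex_addVertex_self (v : Fin n) (x : Chain 𝕜 n) (σ : Finset (Fin n)) :
    removeVertex v (addVertex v x) σ = if v ∈ σ then 0 else x σ := by
  by_cases h : v ∈ σ
  · simp [removeVertex_apply, h]
  · simp [removeVertex_apply, addVertex_apply, h, facetSign_insert_self, ← mul_assoc,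
      facetSign_mul_self]

theorem addVertex_removeVertex_self (v : Fin n) (x : Chain 𝕜 n) (σ : Finset (Fin n)) :
    addVertex v (removeVertex v x) σ = if v ∈ σ then x σ else 0 := by
  by_cases h : v ∈ σ
  · simp [removeVertex_apply, addVertex_apply, h, facetSign_erase_self, ← mul_assoc,
      facetSign_mul_self]
  · simp [addVertex_apply, h]

theorem removeVertex_single (v : Fin n) (τ : Finset (Fin n)) :
    removeVertex v (Pi.single τ 1 : Chain 𝕜 n) =
      if v ∈ τ then facetSign 𝕜 v τ • (Pi.single (τ.erase v) 1 : Chain 𝕜 n) else 0 := by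
  ext σ
  rw [removeVertex_apply]
  by_cases hσ : v ∈ σ
  · have : σ ≠ τ.erase v := fun h => by simp [h] at hσ
    by_cases hτ : v ∈ τ <;> simp [hσ, hτ, this]
  · by_cases hτ : v ∈ τ
    · rw [if_neg hσ, if_pos hτ]
      by_cases h : σ = τ.erase v
      · subst h
        simp [Finset.insert_erase hτ, facetSign_erase_self]
      · have : insert v σ ≠ τ := fun h' => h (by rw [← h', Finset.erase_insert hσ])
        simp [h, this]
    · have : insert v σ ≠ τ := fun h => hτ (by rw [← h]; simp)
      simp [hτ, this]

theorem boundary_single (τ : Finset (Fin n)) :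
    boundary 𝕜 (Pi.single τ 1) =
      ∑ v ∈ τ, facetSign 𝕜 v τ • (Pi.single (τ.erase v) 1 : Chain 𝕜 n) := by
  classical
  rw [boundary, Fintype.linearCombination_apply_single, one_smul]

theorem chain_eq_sum (x : Chain 𝕜 n) : x = ∑ τ, x τ • (Pi.single τ 1 : Chain 𝕜 n) := by
  classical
  exact pi_eq_sum_univ' x

/-- Splitting the boundary by the removed vertex lets the same pieces serve in `descent`, where each
of them also shifts the degree. -/
theorem boundary_eq_sum : boundary 𝕜 (n := n) = ∑ v, removeVertex v := by
  refine LinearMap.pi_ext' fun τ => LinearMap.ext_ring ?_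
  simp only [LinearMap.comp_apply, LinearMap.single_apply, LinearMap.sum_apply]
  rw [boundary_single]
  simp only [removeVertex_single]
  rw [← Finset.sum_filter]
  simp

theorem boundary_apply_eq_sum (x : Chain 𝕜 n) : boundary 𝕜 x = ∑ v, removeVertex v x := by
  rw [boundary_eq_sum, LinearMap.sum_apply]

/-- A sum over pairs vanishes if the terms of `(v, w)` and `(w, v)` cancel and the diagonal
terms vanish. -/
theorem sum_sum_eq_zero_of_antisymm {ι M : Type*} [Fintype ι] [AddCommGroup M] (f : ι → ι → M)
    (h : ∀ v w, f v w + f w v = 0) (h0 : ∀ v, f v v = 0) : ∑ v, ∑ w, f v w = 0 := by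
  classical
  rw [← Finset.sum_product']
  refine Finset.sum_involution (fun q _ => (q.2, q.1)) (fun q _ => h _ _) (fun q _ hq heq => hq ?_)
    (fun q _ => by simp) (fun q _ => rfl)
  have : q.2 = q.1 := (Prod.ext_iff.1 heq).1
  rw [this, h0]

theorem boundary_boundary (x : Chain 𝕜 n) : boundary 𝕜 (boundary 𝕜 x) = 0 := by
  simp only [boundary_apply_eq_sum, map_sum]
  exact sum_sum_eq_zero_of_antisymm _ (fun v w => removeVertex_removeVertex w v x)
    fun v => removeVertex_removeVertex_self v x

/-- Two linear maps that agree on the faces in `T` agree on the span of `T`. -/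
theorem eqOn_facesSpan {N : Type*} [AddCommGroup N] [Module 𝕜 N] {T : Set (Finset (Fin n))}
    {f g : Chain 𝕜 n →ₗ[𝕜] N} (h : ∀ τ ∈ T, f (Pi.single τ 1) = g (Pi.single τ 1))
    {x : Chain 𝕜 n} (hx : x ∈ facesSpan 𝕜 T) : f x = g x := by
  rw [chain_eq_sum x, map_sum, map_sum]
  refine Finset.sum_congr rfl fun τ _ => ?_
  rw [map_smul, map_smul]
  by_cases hτ : τ ∈ T
  · rw [h τ hτ]
  · rw [hx τ hτ, zero_smul, zero_smul]

/-- A linear map that sends the faces in `T` to a submodule `N` sends the span of `T` to `N`. -/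
theorem map_mem_of_facesSpan {N : Type*} [AddCommGroup N] [Module 𝕜 N] {T : Set (Finset (Fin n))}
    {f : Chain 𝕜 n →ₗ[𝕜] N} {P : Submodule 𝕜 N} (h : ∀ τ ∈ T, f (Pi.single τ 1) ∈ P)
    {x : Chain 𝕜 n} (hx : x ∈ facesSpan 𝕜 T) : f x ∈ P := by
  rw [chain_eq_sum x, map_sum]
  refine Submodule.sum_mem _ fun τ _ => ?_
  rw [map_smul]
  by_cases hτ : τ ∈ T
  · exact P.smul_mem _ (h τ hτ)
  · rw [hx τ hτ, zero_smul]
    exact P.zero_mem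

theorem boundary_mem_chains {K : LowerSet (Finset (Fin n))} {k : ℕ} {x : Chain 𝕜 n}
    (hx : x ∈ chains 𝕜 K (k + 1)) : boundary 𝕜 x ∈ chains 𝕜 K k :=
  boundaries_le_chains K k ⟨x, hx, rfl⟩

theorem boundary_mem_boundaries {K : LowerSet (Finset (Fin n))} {k : ℕ} {x : Chain 𝕜 n}
    (hx : x ∈ chains 𝕜 K (k + 1)) : boundary 𝕜 x ∈ boundaries 𝕜 K k :=
  ⟨x, hx, rfl⟩

theorem removeVertex_eq_zero_of_mem_chains_zero {K : LowerSet (Finset (Fin n))} {x : Chain 𝕜 n}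
    (hx : x ∈ chains 𝕜 K 0) (v : Fin n) : removeVertex v x = 0 := by
  ext σ
  rw [removeVertex_apply]
  split_ifs
  · rfl
  · rw [hx _ fun h => by simpa using h.2, mul_zero]
    rfl

theorem boundary_eq_zero_of_mem_chains_zero {K : LowerSet (Finset (Fin n))} {x : Chain 𝕜 n}
    (hx : x ∈ chains 𝕜 K 0) : boundary 𝕜 x = 0 := by
  rw [boundary_apply_eq_sum]
  exact Finset.sum_eq_zero fun v _ => removeVertex_eq_zero_of_mem_chains_zero hx v

end Vertices

/-! ### The splitting of the chain complex given by a community -/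

section Splitting

variable {𝕜 : Type*} [Field 𝕜] {n : ℕ} {K : LowerSet (Finset (Fin n))} (𝒞 : Community 𝕜 K)

theorem theChain_eq_zero {P : Chain 𝕜 n → Prop} (h : ∀ c, ¬ P c) : theChain P = 0 := by
  rw [theChain, dif_neg]
  rintro ⟨c, hc, -⟩
  exact h c hc

theorem theChain_eq {P : Chain 𝕜 n → Prop} (h : ∃! c, P c) {c : Chain 𝕜 n} (hc : P c) :
    theChain P = c :=
  h.unique (theChain_spec h) hc

/-- The linear map that sends each stake to its shrub, and all other faces to `0`. -/
noncomputable def shrubMap : Chain 𝕜 n →ₗ[𝕜] Chain 𝕜 n :=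
  Fintype.linearCombination 𝕜 fun σ : Finset (Fin n) => theChain (IsShrub 𝒞 σ.card σ)

theorem shrubMap_single (σ : Finset (Fin n)) :
    shrubMap 𝒞 (Pi.single σ 1) = theChain (IsShrub 𝒞 σ.card σ) := by
  classical
  rw [shrubMap, Fintype.linearCombination_apply_single, one_smul]

variable {𝒞}

/-- For a non-stake, the boundary of a candidate would vanish on every stake, hence vanish
altogether, against its coefficient 1 on `σ`. So the default value applies, and `shrubMap` needs no
case distinction. -/
theorem theChain_isShrub_eq_zero {k : ℕ} {σ : Finset (Fin n)} (hσ : σ ∉ 𝒞.stakes k) :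
    theChain (IsShrub 𝒞 k σ) = 0 := by
  refine theChain_eq_zero fun s hs => ?_
  obtain ⟨hT, hmap, -, -⟩ := 𝒞.isShrubbery (k + 1)
  obtain ⟨-, hinj, -⟩ := 𝒞.isStakeSet k
  have h0 : (⟨boundary 𝕜 s, hmap hs.1⟩ : boundaries 𝕜 K k) = 0 :=
    hinj (funext fun σ' => hs.2.2 σ' σ'.2 fun h => hσ (h ▸ σ'.2))
  have h1 : boundary 𝕜 s σ = 0 := congrFun (congrArg Subtype.val h0) σ
  exact one_ne_zero (hs.2.1.symm.trans h1)

theorem shrubMap_single_of_notMem {k : ℕ} {σ : Finset (Fin n)} (hk : σ.card = k)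
    (hσ : σ ∉ 𝒞.stakes k) : shrubMap 𝒞 (Pi.single σ 1) = 0 := by
  rw [shrubMap_single, hk, theChain_isShrub_eq_zero hσ]

theorem card_of_mem_stakes {k : ℕ} {σ : Finset (Fin n)} (hσ : σ ∈ 𝒞.stakes k) : σ.card = k :=
  ((𝒞.isStakeSet k).1 hσ).2

theorem isShrub_shrubMap {k : ℕ} {σ : Finset (Fin n)} (hσ : σ ∈ 𝒞.stakes k) :
    IsShrub 𝒞 k σ (shrubMap 𝒞 (Pi.single σ 1)) := by
  rw [shrubMap_single, card_of_mem_stakes hσ]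
  exact theChain_spec (existsUnique_isShrub 𝒞 hσ)

theorem shrubMap_mem {k : ℕ} {x : Chain 𝕜 n} (hx : x ∈ chains 𝕜 K k) :
    shrubMap 𝒞 x ∈ facesSpan 𝕜 (𝒞.shrubs (k + 1)) := by
  refine map_mem_of_facesSpan (fun τ hτ => ?_) hx
  by_cases h : τ ∈ 𝒞.stakes k
  · exact (isShrub_shrubMap h).1
  · rw [shrubMap_single_of_notMem hτ.2 h]
    exact Submodule.zero_mem _

theorem shrubMap_mem_chains {k : ℕ} {x : Chain 𝕜 n} (hx : x ∈ chains 𝕜 K k) :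
    shrubMap 𝒞 x ∈ chains 𝕜 K (k + 1) :=
  facesSpan_mono (𝒞.isShrubbery (k + 1)).1 (shrubMap_mem hx)

theorem boundary_shrubMap_apply {k : ℕ} {x : Chain 𝕜 n} (hx : x ∈ chains 𝕜 K k)
    {σ : Finset (Fin n)} (hσ : σ ∈ 𝒞.stakes k) : boundary 𝕜 (shrubMap 𝒞 x) σ = x σ := by
  refine eqOn_facesSpan (f := LinearMap.proj σ ∘ₗ boundary 𝕜 ∘ₗ shrubMap 𝒞)
    (g := LinearMap.proj σ) (fun τ hτ => ?_) hx
  simp only [LinearMap.comp_apply, LinearMap.proj_apply]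
  by_cases h : τ ∈ 𝒞.stakes k
  · by_cases hστ : σ = τ
    · subst hστ
      rw [(isShrub_shrubMap h).2.1, Pi.single_eq_same]
    · rw [(isShrub_shrubMap h).2.2 σ hσ hστ, Pi.single_eq_of_ne hστ]
  · have hστ : σ ≠ τ := fun h' => h (h' ▸ hσ)
    rw [shrubMap_single_of_notMem hτ.2 h, Pi.single_eq_of_ne hστ, map_zero, Pi.zero_apply]

/-- Both sides are boundaries with the same coefficients on the stakes, and these determine a
boundary. -/
theorem boundary_shrubMap {k : ℕ} {β : Chain 𝕜 n} (hβ : β ∈ boundaries 𝕜 K k) :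
    boundary 𝕜 (shrubMap 𝒞 β) = β := by
  have hβc := boundaries_le_chains K k hβ
  have := (𝒞.isStakeSet k).2.1 (a₁ := ⟨_, boundary_mem_boundaries (shrubMap_mem_chains hβc)⟩)
    (a₂ := ⟨β, hβ⟩) (funext fun σ => boundary_shrubMap_apply hβc σ.2)
  exact congrArg Subtype.val this

theorem boundary_shrubMap_boundary {k : ℕ} {x : Chain 𝕜 n} (hx : x ∈ chains 𝕜 K k) :
    boundary 𝕜 (shrubMap 𝒞 (boundary 𝕜 x)) = boundary 𝕜 x := by
  cases k with
  | zero => rw [boundary_eq_zero_of_mem_chains_zero hx, map_zero, map_zero]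
  | succ k => exact boundary_shrubMap (boundary_mem_boundaries hx)

/-- Both sides lie in the span of the shrubbery, where the boundary map is injective, and have the
same boundary. -/
theorem shrubMap_boundary_shrubMap {k : ℕ} {x : Chain 𝕜 n} (hx : x ∈ chains 𝕜 K k) :
    shrubMap 𝒞 (boundary 𝕜 (shrubMap 𝒞 x)) = shrubMap 𝒞 x := by
  have h := shrubMap_mem_chains (𝒞 := 𝒞) hx
  exact (𝒞.isShrubbery (k + 1)).2.2.1 (shrubMap_mem (boundary_mem_chains h)) (shrubMap_mem hx)
    (boundary_shrubMap (boundary_mem_boundaries h))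

/-- This is where the disjointness in a community enters: shrubs are supported on faces that are not
stakes. -/
theorem shrubMap_shrubMap {k : ℕ} {x : Chain 𝕜 n} (hx : x ∈ chains 𝕜 K k) :
    shrubMap 𝒞 (shrubMap 𝒞 x) = 0 := by
  refine eqOn_facesSpan (g := 0) (fun τ hτ => ?_) (shrubMap_mem hx)
  exact shrubMap_single_of_notMem ((𝒞.isShrubbery (k + 1)).1 hτ).2
    fun h => (𝒞.disjoint (k + 1)).le_bot ⟨hτ, h⟩

variable (𝒞) in
/-- The linear map that sends each face to its hedge rim. -/
noncomputable def rimMap : Chain 𝕜 n →ₗ[𝕜] Chain 𝕜 n :=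
  LinearMap.id - boundary 𝕜 ∘ₗ shrubMap 𝒞

variable (𝒞) in
/-- The linear map that sends each face to its circuit. -/
noncomputable def circuitMap : Chain 𝕜 n →ₗ[𝕜] Chain 𝕜 n :=
  LinearMap.id - shrubMap 𝒞 ∘ₗ boundary 𝕜

theorem rimMap_apply (x : Chain 𝕜 n) : rimMap 𝒞 x = x - boundary 𝕜 (shrubMap 𝒞 x) := rfl

theorem circuitMap_apply (x : Chain 𝕜 n) :
    circuitMap 𝒞 x = x - shrubMap 𝒞 (boundary 𝕜 x) := rfl

theorem rimMap_mem {k : ℕ} {x : Chain 𝕜 n} (hx : x ∈ chains 𝕜 K k) :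
    rimMap 𝒞 x ∈ chains 𝕜 K k :=
  Submodule.sub_mem _ hx (boundary_mem_chains (shrubMap_mem_chains hx))

theorem circuitMap_mem_cycles {k : ℕ} {x : Chain 𝕜 n} (hx : x ∈ chains 𝕜 K k) :
    circuitMap 𝒞 x ∈ cycles 𝕜 K k := by
  refine ⟨Submodule.sub_mem _ hx ?_, ?_⟩
  · cases k with
    | zero =>
      rw [LinearMap.comp_apply, boundary_eq_zero_of_mem_chains_zero hx, map_zero]
      exact Submodule.zero_mem _
    | succ k => exact shrubMap_mem_chains (boundary_mem_chains hx)
  · rw [SetLike.mem_coe, LinearMap.mem_ker, circuitMap_apply, map_sub, boundary_shrubMap_boundary hx, sub_self]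

theorem rimMap_eq_zero {k : ℕ} {β : Chain 𝕜 n} (hβ : β ∈ boundaries 𝕜 K k) :
    rimMap 𝒞 β = 0 := by
  rw [rimMap_apply, boundary_shrubMap hβ, sub_self]

/-- Subtracting the boundary of the shrubs clears all stakes and changes the face only by a
boundary; uniqueness of the hedge rim does the rest. -/
theorem rimCoeff_eq {k : ℕ} {ρ : Finset (Fin n)} (hρ : ρ ∈ faces K k) (ρ' : Finset (Fin n)) :
    rimCoeff 𝒞 k ρ ρ' = rimMap 𝒞 (Pi.single ρ 1) ρ' := by
  have hc : (Pi.single ρ 1 : Chain 𝕜 n) ∈ chains 𝕜 K k := single_mem_facesSpan hρ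
  rw [rimCoeff, theChain_eq (existsUnique_isHedgeRim 𝒞 hρ)]
  refine ⟨fun τ hτ => ?_, ?_⟩
  · by_cases h : τ ∈ faces K k
    · have hS : τ ∈ 𝒞.stakes k := by_contra fun h' => hτ ⟨h, h'⟩
      rw [rimMap_apply, Pi.sub_apply, boundary_shrubMap_apply hc hS, sub_self]
    · exact rimMap_mem hc τ h
  · rw [rimMap_apply, sub_sub_cancel]
    exact boundary_mem_boundaries (shrubMap_mem_chains hc)

theorem circuitCoeff_eq {k : ℕ} {σ : Finset (Fin n)} (hσ : σ ∈ faces K k)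
    (σ' : Finset (Fin n)) : circuitCoeff 𝒞 k σ σ' = circuitMap 𝒞 (Pi.single σ 1) σ' := by
  have hc : (Pi.single σ 1 : Chain 𝕜 n) ∈ chains 𝕜 K k := single_mem_facesSpan hσ
  rw [circuitCoeff, theChain_eq (existsUnique_isCircuit 𝒞 hσ)]
  refine ⟨circuitMap_mem_cycles hc, ?_⟩
  rw [circuitMap_apply, sub_sub_cancel]
  cases k with
  | zero =>
    rw [boundary_eq_zero_of_mem_chains_zero hc, map_zero]
    exact Submodule.zero_mem _
  | succ k => exact shrubMap_mem (boundary_mem_chains hc)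

theorem shrubCoeff_eq {k : ℕ} {σ : Finset (Fin n)} (hσ : σ.card = k) (τ : Finset (Fin n)) :
    shrubCoeff 𝒞 k σ τ = shrubMap 𝒞 (Pi.single σ 1) τ := by
  rw [shrubMap_single, hσ, shrubCoeff]

theorem mem_faces_of_rimCoeff_ne_zero {k : ℕ} {ρ ρ' : Finset (Fin n)} (hρ : ρ ∈ faces K k)
    (h : rimCoeff 𝒞 k ρ ρ' ≠ 0) : ρ' ∈ faces K k := by
  by_contra h'
  refine h ?_
  rw [rimCoeff_eq hρ]
  exact rimMap_mem (single_mem_facesSpan hρ) _ h'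

theorem mem_stakes_of_shrubCoeff_ne_zero {k : ℕ} {σ τ : Finset (Fin n)}
    (h : shrubCoeff 𝒞 k σ τ ≠ 0) : σ ∈ 𝒞.stakes k := by
  by_contra h'
  exact h (by rw [shrubCoeff, theChain_isShrub_eq_zero h', Pi.zero_apply])

theorem mem_faces_of_shrubCoeff_ne_zero {k : ℕ} {σ τ : Finset (Fin n)}
    (h : shrubCoeff 𝒞 k σ τ ≠ 0) : τ ∈ faces K (k + 1) := by
  have hσ := mem_stakes_of_shrubCoeff_ne_zero h
  by_contra h'
  refine h ((theChain_spec (existsUnique_isShrub 𝒞 hσ)).1 τ fun hτ => h' ?_)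
  exact (𝒞.isShrubbery (k + 1)).1 hτ

/-- A set that is not a face has no circuit, since cycles and chains on the shrubbery both vanish on
it; the coefficient is then the default 0. -/
theorem source_mem_faces_of_circuitCoeff_ne_zero {k : ℕ} {σ σ' : Finset (Fin n)}
    (h : circuitCoeff 𝒞 k σ σ' ≠ 0) : σ ∈ faces K k := by
  by_contra hσ
  refine h ?_
  rw [circuitCoeff, theChain_eq_zero, Pi.zero_apply]
  rintro z ⟨⟨hz, -⟩, hzt⟩
  have h1 : (Pi.single σ 1 - z : Chain 𝕜 n) σ = 0 := hzt σ fun h' => hσ ((𝒞.isShrubbery k).1 h')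
  rw [Pi.sub_apply, hz σ hσ, Pi.single_eq_same, sub_zero] at h1
  exact one_ne_zero h1

theorem target_mem_faces_of_circuitCoeff_ne_zero {k : ℕ} {σ σ' : Finset (Fin n)}
    (h : circuitCoeff 𝒞 k σ σ' ≠ 0) : σ' ∈ faces K k := by
  by_contra h'
  exact h ((theChain_spec (existsUnique_isCircuit 𝒞
    (source_mem_faces_of_circuitCoeff_ne_zero h))).1.1 _ h')

end Splitting

/-! ### The strands of the Koszul resolution -/

section Strand

variable {𝕜 : Type*} [Field 𝕜] {n : ℕ}

theorem charVec_insert {v : Fin n} {σ : Finset (Fin n)} (hv : v ∉ σ) :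
    charVec (insert v σ) = charVec σ + Finsupp.single v 1 := by
  rw [charVec, Finset.sum_insert hv, add_comm, charVec]

theorem one_le_of_charVec_le {v : Fin n} {τ : Finset (Fin n)} (hv : v ∈ τ) {b : Fin n →₀ ℕ}
    (h : charVec τ ≤ b) : Finsupp.single v 1 ≤ b :=
  le_trans (by
    rw [← Finset.insert_erase hv, charVec_insert (Finset.notMem_erase v τ)]
    exact self_le_add_left _ _) h

theorem mem_koszul {I : Ideal (MvPolynomial (Fin n) 𝕜)} {b : Fin n →₀ ℕ} {τ : Finset (Fin n)} :
    τ ∈ koszul I b ↔ charVec τ ≤ b ∧ MvPolynomial.monomial (b - charVec τ) (1 : 𝕜) ∈ I := Iff.rfl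

/-- The monomial x^(b-τ) does not change when `v` is removed from both `b` and τ. This is why
`descent` respects the Koszul complexes. -/
theorem insert_mem_koszul_add {I : Ideal (MvPolynomial (Fin n) 𝕜)} {a : Fin n →₀ ℕ} {v : Fin n}
    {σ : Finset (Fin n)} (hv : v ∉ σ) :
    insert v σ ∈ koszul I (a + Finsupp.single v 1) ↔ σ ∈ koszul I a := by
  rw [mem_koszul, mem_koszul, charVec_insert hv, add_le_add_iff_right,
    add_tsub_add_eq_tsub_right]

variable (𝕜 n) in
/-- Families of chains indexed by degrees. -/
abbrev Multichain : Type _ := (Fin n →₀ ℕ) → Chain 𝕜 n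

/-- The families whose member of degree `b` is supported on `F b` and vanishes unless `b ≤ c`. -/
def multispan (F : (Fin n →₀ ℕ) → Set (Finset (Fin n))) (c : Fin n →₀ ℕ) :
    Submodule 𝕜 (Multichain 𝕜 n) where
  carrier := {x | ∀ b, x b ∈ facesSpan 𝕜 (F b) ∧ (¬ b ≤ c → x b = 0)}
  add_mem' hx hy b := ⟨Submodule.add_mem _ (hx b).1 (hy b).1, fun h => by
    rw [Pi.add_apply, (hx b).2 h, (hy b).2 h, add_zero]⟩
  zero_mem' b := ⟨Submodule.zero_mem _, fun _ => rfl⟩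
  smul_mem' t x hx b := ⟨Submodule.smul_mem _ _ (hx b).1, fun h => by
    rw [Pi.smul_apply, (hx b).2 h, smul_zero]⟩

theorem multispan_mono {F F' : (Fin n →₀ ℕ) → Set (Finset (Fin n))} (h : ∀ b, F b ⊆ F' b)
    (c : Fin n →₀ ℕ) : multispan (𝕜 := 𝕜) F c ≤ multispan F' c :=
  fun _ hx b => ⟨facesSpan_mono (h b) (hx b).1, (hx b).2⟩

variable (I : Ideal (MvPolynomial (Fin n) 𝕜)) (c : Fin n →₀ ℕ)

/-- The strand of degree `c` of the Koszul resolution of `I`. -/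
abbrev strand : Submodule 𝕜 (Multichain 𝕜 n) := multispan (fun b => {τ | τ ∈ koszul I b}) c

/-- The part of the strand of degree `c` that is spanned by faces with `k` vertices. -/
abbrev strandPart (k : ℕ) : Submodule 𝕜 (Multichain 𝕜 n) :=
  multispan (fun b => faces (koszul I b) k) c

variable {I c}

theorem strandPart_le_strand (k : ℕ) : strandPart I c k ≤ strand I c :=
  multispan_mono (fun _ _ h => h.1) c

theorem single_mem_multispan {F : (Fin n →₀ ℕ) → Set (Finset (Fin n))} {b : Fin n →₀ ℕ}
    (hb : b ≤ c) {x : Chain 𝕜 n} (hx : x ∈ facesSpan 𝕜 (F b)) :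
    (Pi.single b x : Multichain 𝕜 n) ∈ multispan F c := by
  intro b'
  by_cases h : b' = b
  · subst h
    rw [Pi.single_eq_same]
    exact ⟨hx, fun h => absurd hb h⟩
  · rw [Pi.single_eq_of_ne h]
    exact ⟨Submodule.zero_mem _, fun _ => rfl⟩

/-- Applying a linear map in each degree. -/
def degreewise (f : (Fin n →₀ ℕ) → Chain 𝕜 n →ₗ[𝕜] Chain 𝕜 n) :
    Module.End 𝕜 (Multichain 𝕜 n) :=
  LinearMap.pi fun b => f b ∘ₗ LinearMap.proj b

@[simp]
theorem degreewise_apply (f : (Fin n →₀ ℕ) → Chain 𝕜 n →ₗ[𝕜] Chain 𝕜 n) (x : Multichain 𝕜 n)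
    (b : Fin n →₀ ℕ) : degreewise f x b = f b (x b) := rfl

theorem degreewise_mem {f : (Fin n →₀ ℕ) → Chain 𝕜 n →ₗ[𝕜] Chain 𝕜 n}
    {F F' : (Fin n →₀ ℕ) → Set (Finset (Fin n))}
    (h : ∀ b, ∀ x ∈ facesSpan 𝕜 (F b), f b x ∈ facesSpan 𝕜 (F' b)) {x : Multichain 𝕜 n}
    (hx : x ∈ multispan F c) : degreewise f x ∈ multispan F' c :=
  fun b => ⟨h b _ (hx b).1, fun hb => by rw [degreewise_apply, (hx b).2 hb, map_zero]⟩

variable (𝕜 n) in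
/-- The simplicial boundary in each degree. -/
noncomputable def levelBoundary : Module.End 𝕜 (Multichain 𝕜 n) :=
  degreewise fun _ => boundary 𝕜

variable (𝕜 n) in
/-- The part of the Koszul differential that removes a vertex and decreases the degree by it. -/
noncomputable def descent : Module.End 𝕜 (Multichain 𝕜 n) :=
  LinearMap.pi fun a => ∑ v, removeVertex v ∘ₗ LinearMap.proj (a + Finsupp.single v 1)

theorem levelBoundary_apply (x : Multichain 𝕜 n) (b : Fin n →₀ ℕ) :
    levelBoundary 𝕜 n x b = boundary 𝕜 (x b) := rfl

theorem descent_apply (x : Multichain 𝕜 n) (a : Fin n →₀ ℕ) :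
    descent 𝕜 n x a = ∑ v, removeVertex v (x (a + Finsupp.single v 1)) := by
  simp [descent]

theorem descent_mem {F F' : (Fin n →₀ ℕ) → Set (Finset (Fin n))}
    (h : ∀ a v σ, v ∉ σ → insert v σ ∈ F (a + Finsupp.single v 1) → σ ∈ F' a)
    {x : Multichain 𝕜 n} (hx : x ∈ multispan F c) : descent 𝕜 n x ∈ multispan F' c := by
  refine fun a => ⟨?_, fun ha => ?_⟩
  · rw [descent_apply]
    refine Submodule.sum_mem _ fun v _ σ hσ => ?_
    rw [removeVertex_apply]
    split_ifs with hv
    · rfl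
    · rw [(hx _).1 _ fun h' => hσ (h a v σ hv h'), mul_zero]
  · rw [descent_apply]
    refine Finset.sum_eq_zero fun v _ => ?_
    rw [(hx _).2 fun h' => ha (le_trans (self_le_add_right _ _) h'), map_zero]

theorem descent_mem_strand {x : Multichain 𝕜 n} (hx : x ∈ strand I c) :
    descent 𝕜 n x ∈ strand I c :=
  descent_mem (fun _ _ _ hv => (insert_mem_koszul_add hv).1) hx

theorem descent_mem_strandPart {k : ℕ} {x : Multichain 𝕜 n} (hx : x ∈ strandPart I c (k + 1)) :
    descent 𝕜 n x ∈ strandPart I c k := by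
  refine descent_mem (F' := fun b => faces (koszul I b) k) (fun a v σ hv h => ⟨(insert_mem_koszul_add hv).1 h.1, ?_⟩) hx
  have := h.2
  rw [Finset.card_insert_of_notMem hv] at this
  omega

theorem descent_eq_zero {x : Multichain 𝕜 n} (hx : x ∈ strandPart I c 0) :
    descent 𝕜 n x = 0 := by
  ext1 a
  rw [descent_apply]
  exact Finset.sum_eq_zero fun v _ => removeVertex_eq_zero_of_mem_chains_zero (hx _).1 v

theorem boundary_mem_facesSpan (K : LowerSet (Finset (Fin n))) {x : Chain 𝕜 n}
    (hx : x ∈ facesSpan 𝕜 {τ | τ ∈ K}) : boundary 𝕜 x ∈ facesSpan 𝕜 {τ | τ ∈ K} := by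
  rw [boundary_apply_eq_sum]
  refine Submodule.sum_mem _ fun v _ σ hσ => ?_
  rw [removeVertex_apply]
  split_ifs with hv
  · rfl
  · rw [hx _ fun h => hσ (K.lower (Finset.subset_insert _ _) h), mul_zero]

theorem levelBoundary_mem_strand {x : Multichain 𝕜 n} (hx : x ∈ strand I c) :
    levelBoundary 𝕜 n x ∈ strand I c :=
  degreewise_mem (fun b _ h => boundary_mem_facesSpan (koszul I b) h) hx

theorem levelBoundary_mem_strandPart {k : ℕ} {x : Multichain 𝕜 n}
    (hx : x ∈ strandPart I c (k + 1)) : levelBoundary 𝕜 n x ∈ strandPart I c k :=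
  degreewise_mem (fun _ _ => boundary_mem_chains) hx

theorem levelBoundary_eq_zero {x : Multichain 𝕜 n} (hx : x ∈ strandPart I c 0) :
    levelBoundary 𝕜 n x = 0 :=
  funext fun b => boundary_eq_zero_of_mem_chains_zero (hx b).1

theorem levelBoundary_mul_self : levelBoundary 𝕜 n * levelBoundary 𝕜 n = 0 :=
  LinearMap.ext fun x => funext fun b => boundary_boundary (x b)

theorem descent_mul_self : descent 𝕜 n * descent 𝕜 n = 0 := by
  ext1 x
  funext a
  simp only [Module.End.mul_apply, descent_apply, map_sum]
  refine sum_sum_eq_zero_of_antisymm _ (fun v w => ?_) fun v => removeVertex_removeVertex_self v _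
  rw [add_right_comm a]
  exact removeVertex_removeVertex v w _

theorem levelBoundary_descent :
    levelBoundary 𝕜 n * descent 𝕜 n + descent 𝕜 n * levelBoundary 𝕜 n = 0 := by
  ext1 x
  funext a
  simp only [Module.End.mul_apply, descent_apply, map_sum, LinearMap.add_apply, Pi.add_apply,
    levelBoundary_apply, boundary_apply_eq_sum, LinearMap.zero_apply]
  rw [← Finset.sum_add_distrib]
  refine Finset.sum_eq_zero fun v _ => ?_
  rw [← Finset.sum_add_distrib]
  exact Finset.sum_eq_zero fun w _ => removeVertex_removeVertex w v _

variable (𝕜 n) in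
/-- The Koszul differential on the strands. -/
noncomputable def koszulD : Module.End 𝕜 (Multichain 𝕜 n) := levelBoundary 𝕜 n - descent 𝕜 n

theorem koszulD_mul_self : koszulD 𝕜 n * koszulD 𝕜 n = 0 := by
  have h : koszulD 𝕜 n * koszulD 𝕜 n = levelBoundary 𝕜 n * levelBoundary 𝕜 n +
      descent 𝕜 n * descent 𝕜 n -
      (levelBoundary 𝕜 n * descent 𝕜 n + descent 𝕜 n * levelBoundary 𝕜 n) := by
    rw [koszulD, sub_mul, mul_sub, mul_sub]; abel
  rw [h, levelBoundary_mul_self, descent_mul_self, levelBoundary_descent]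
  simp

theorem koszulD_koszulD (x : Multichain 𝕜 n) : koszulD 𝕜 n (koszulD 𝕜 n x) = 0 :=
  LinearMap.congr_fun koszulD_mul_self x

theorem koszulD_mem_strandPart {k : ℕ} {x : Multichain 𝕜 n}
    (hx : x ∈ strandPart I c (k + 1)) : koszulD 𝕜 n x ∈ strandPart I c k :=
  Submodule.sub_mem _ (levelBoundary_mem_strandPart hx) (descent_mem_strandPart hx)

theorem koszulD_eq_zero {x : Multichain 𝕜 n} (hx : x ∈ strandPart I c 0) :
    koszulD 𝕜 n x = 0 := by
  rw [koszulD, LinearMap.sub_apply, levelBoundary_eq_zero hx, descent_eq_zero hx, sub_zero]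

/-! ### Exactness of the strands -/

theorem koszulD_apply (x : Multichain 𝕜 n) (b : Fin n →₀ ℕ) :
    koszulD 𝕜 n x b = ∑ v, (removeVertex v (x b) - removeVertex v (x (b + Finsupp.single v 1))) := by
  rw [koszulD, LinearMap.sub_apply, Pi.sub_apply, levelBoundary_apply, descent_apply,
    boundary_apply_eq_sum, Finset.sum_sub_distrib]

variable (c) in
/-- The homotopy that adds the vertex `w` and increases the degree by it. -/
noncomputable def ascent (w : Fin n) (x : Multichain 𝕜 n) : Multichain 𝕜 n := fun b =>
  open Classical in if Finsupp.single w 1 ≤ b ∧ b ≤ c then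
    addVertex w (x (b - Finsupp.single w 1)) else 0

variable (c) in
/-- The translation by the vertex `w`, which stops at the degrees whose coordinate at `w` is that
of `c`. -/
noncomputable def push (w : Fin n) (x : Multichain 𝕜 n) : Multichain 𝕜 n := fun b σ =>
  open Classical in
  (if Finsupp.single w 1 ≤ b ∧ b ≤ c then x (b - Finsupp.single w 1) σ else 0) +
    if w ∉ σ ∧ b w = c w then x b σ else 0

theorem ascent_mem_strandPart {k : ℕ} {x : Multichain 𝕜 n} (hx : x ∈ strandPart I c k)
    (w : Fin n) : ascent c w x ∈ strandPart I c (k + 1) := by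
  refine fun b => ⟨fun τ hτ => ?_, fun hb => by rw [ascent, if_neg fun h => hb h.2]⟩
  rw [ascent]
  split_ifs with h
  · rw [addVertex_apply]
    split_ifs with hw
    · rw [(hx _).1, mul_zero]
      refine fun h' => hτ ⟨?_, ?_⟩
      · have := (insert_mem_koszul_add (Finset.notMem_erase w τ)).2 h'.1
        rwa [tsub_add_cancel_of_le h.1, Finset.insert_erase hw] at this
      · rw [← h'.2, Finset.card_erase_add_one hw]
    · rfl
  · rfl

theorem le_iff_of_single {v : Fin n} {b : Fin n →₀ ℕ} (hb : b ≤ c) :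
    b + Finsupp.single v 1 ≤ c ↔ b v ≠ c v := by
  constructor
  · intro h h'
    have := h v
    simp at this
    omega
  · intro h u
    have := hb u
    by_cases hu : u = v
    · subst hu
      simp
      omega
    · simpa [Finsupp.single_apply, Ne.symm hu] using this

/-- Adding `w` and then removing it by the simplicial boundary shifts the degree by `w`; removing it
by the descent returns to the start and gives the term `-x`. The cut-off at `c` blocks the second
cancellation in degrees that cannot be raised, which explains the stationary term of `push`. -/
theorem koszulD_ascent_add {k : ℕ} {x : Multichain 𝕜 n} (hx : x ∈ strandPart I c k) (w : Fin n) :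
    koszulD 𝕜 n (ascent c w x) + ascent c w (koszulD 𝕜 n x) = push c w x - x := by
  classical
  funext b
  by_cases hb : b ≤ c
  swap
  · have hb' (v : Fin n) : ¬ b + Finsupp.single v 1 ≤ c :=
      fun h => hb (le_trans (self_le_add_right _ _) h)
    ext σ
    simp [koszulD_apply, ascent, push, hb, hb', (hx b).2 hb]
  -- The contributions of vertices other than `w` cancel, because adding `w` anticommutes with
  -- removing `v`.
  have key (v : Fin n) (hv : v ≠ w) :
      (removeVertex v (ascent c w x b) - removeVertex v (ascent c w x (b + Finsupp.single v 1))) +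
      (if Finsupp.single w 1 ≤ b then addVertex w (removeVertex v (x (b - Finsupp.single w 1)) -
        removeVertex v (x (b - Finsupp.single w 1 + Finsupp.single v 1))) else 0) = 0 := by
    have hle : Finsupp.single w 1 ≤ b + Finsupp.single v 1 ↔ Finsupp.single w 1 ≤ b := by
      simp [Finsupp.single_le_iff, hv]
    by_cases hw : Finsupp.single w 1 ≤ b
    · have h1 := removeVertex_addVertex hv (x (b - Finsupp.single w 1))
      have h2 := removeVertex_addVertex hv (x (b - Finsupp.single w 1 + Finsupp.single v 1))
      rw [if_pos hw, map_sub]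
      simp only [ascent, hw, hb, hle, true_and, if_true]
      by_cases hbv : b + Finsupp.single v 1 ≤ c
      · rw [if_pos hbv, tsub_add_eq_add_tsub hw] at *
        rw [sub_add_sub_comm, h1, h2, sub_zero]
      -- Lowering the coordinate at `w` does not affect the obstruction at `v`, so both sides are
      -- cut off together.
      · have h3 : ¬ b - Finsupp.single w 1 + Finsupp.single v 1 ≤ c := by
          rw [le_iff_of_single hb, not_not] at hbv
          rw [le_iff_of_single (le_trans tsub_le_self hb), not_not, ← hbv]
          simp [Ne.symm hv]
        rw [if_neg hbv, (hx _).2 h3]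
        simpa using h1
    · simp [ascent, hw, hle]
  have hsum : (koszulD 𝕜 n (ascent c w x) + ascent c w (koszulD 𝕜 n x)) b =
      ∑ v, ((removeVertex v (ascent c w x b) -
        removeVertex v (ascent c w x (b + Finsupp.single v 1))) +
      (if Finsupp.single w 1 ≤ b then addVertex w (removeVertex v (x (b - Finsupp.single w 1)) -
        removeVertex v (x (b - Finsupp.single w 1 + Finsupp.single v 1))) else 0)) := by
    rw [Finset.sum_add_distrib, ← koszulD_apply, Pi.add_apply]
    congr 1
    by_cases hw : Finsupp.single w 1 ≤ b
    · simp only [ascent, hw, hb, true_and, if_true, koszulD_apply, map_sum]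
    · simp [ascent, hw]
  rw [hsum, Finset.sum_eq_single w (fun v _ hv => key v hv) (by simp)]
  ext σ
  -- A face of the Koszul complex in degree `b` containing `w` forces `b w` to be positive.
  have hpos : w ∈ σ → ¬ Finsupp.single w 1 ≤ b → x b σ = 0 := fun hσ hw =>
    (hx b).1 σ fun h => hw (one_le_of_charVec_le hσ h.1.1)
  have hle : Finsupp.single w 1 ≤ b + Finsupp.single w 1 := self_le_add_left _ _
  simp only [ascent, hb, hle, true_and, and_true, add_tsub_cancel_right, push, Pi.sub_apply,
    Pi.add_apply, le_iff_of_single hb]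
  by_cases hw : Finsupp.single w 1 ≤ b
  · simp only [hw, if_true, map_sub, Pi.sub_apply, removeVertex_addVertex_self,
      addVertex_removeVertex_self, tsub_add_cancel_of_le hw]
    by_cases hσ : w ∈ σ
    · by_cases hc : b w = c w <;> simp [hσ, hc, removeVertex_addVertex_self]
    · by_cases hc : b w = c w <;> simp [hσ, hc, removeVertex_addVertex_self]
  · simp only [hw, if_false]
    by_cases hσ : w ∈ σ
    · by_cases hc : b w = c w <;>
        simp [hσ, hc, removeVertex_addVertex_self, hpos hσ hw]
    · by_cases hc : b w = c w <;> simp [hσ, hc, removeVertex_addVertex_self]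

/-- Membership is read off from the homotopy formula, all of whose other terms lie in the strand. -/
theorem push_mem_strandPart {k : ℕ} {x : Multichain 𝕜 n} (hx : x ∈ strandPart I c k)
    (w : Fin n) : push c w x ∈ strandPart I c k := by
  have h := koszulD_ascent_add hx w
  rw [eq_sub_iff_add_eq] at h
  rw [← h]
  refine Submodule.add_mem _ (Submodule.add_mem _
    (koszulD_mem_strandPart (ascent_mem_strandPart hx w)) ?_) hx
  cases k with
  | zero =>
    rw [koszulD_eq_zero hx]
    convert Submodule.zero_mem _
    funext b
    simp [ascent]
  | succ k => exact ascent_mem_strandPart (koszulD_mem_strandPart hx) w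

theorem push_homologous {k : ℕ} {x : Multichain 𝕜 n} (hx : x ∈ strandPart I c k)
    (hd : koszulD 𝕜 n x = 0) (w : Fin n) : koszulD 𝕜 n (ascent c w x) = push c w x - x := by
  rw [← koszulD_ascent_add hx w, hd]
  convert (add_zero _).symm
  funext b
  simp [ascent]

/-- Each push raises the coordinate at `w` by one, except for the part that has already settled.
Coordinates at the vertices in `W` are untouched, so what was achieved there persists. -/
theorem exists_homologous_iterate_push {k : ℕ} (W : Finset (Fin n)) {w : Fin n} (hw : w ∉ W)
    {x : Multichain 𝕜 n} (hx : x ∈ strandPart I c k) (hd : koszulD 𝕜 n x = 0)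
    (hW : ∀ b σ, x b σ ≠ 0 → ∀ v ∈ W, v ∉ σ ∧ b v = c v) (m : ℕ) :
    ∃ y ∈ strandPart I c k, ∃ z ∈ strandPart I c (k + 1), y - x = koszulD 𝕜 n z ∧
      ∀ b σ, y b σ ≠ 0 → (∀ v ∈ W, v ∉ σ ∧ b v = c v) ∧ (m ≤ b w ∨ w ∉ σ ∧ b w = c w) := by
  induction m with
  | zero =>
    exact ⟨x, hx, 0, Submodule.zero_mem _, by simp, fun b σ h => ⟨hW b σ h, Or.inl (Nat.zero_le _)⟩⟩
  | succ m ih =>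
    obtain ⟨y, hy, z, hz, hyz, hs⟩ := ih
    have hyd : koszulD 𝕜 n y = 0 := by
      rw [← sub_add_cancel y x, hyz, map_add, koszulD_koszulD, hd, add_zero]
    refine ⟨push c w y, push_mem_strandPart hy w, ascent c w y + z,
      Submodule.add_mem _ (ascent_mem_strandPart hy w) hz, ?_, fun b σ h => ?_⟩
    · rw [map_add, push_homologous hy hyd, ← hyz, sub_add_sub_cancel]
    · by_cases h1 : w ∉ σ ∧ b w = c w
      · refine ⟨fun v hv => ?_, Or.inr h1⟩
        rw [push] at h
        by_cases h2 : y b σ = 0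
        · rw [h2, ite_self, add_zero] at h
          have h3 : y (b - Finsupp.single w 1) σ ≠ 0 := fun h' => h (by rw [h', ite_self])
          have := (hs _ _ h3).1 v hv
          have hvw : w ≠ v := fun h' => hw (h' ▸ hv)
          simpa [Finsupp.single_apply, hvw] using this
        · exact (hs _ _ h2).1 v hv
      · rw [push, if_neg h1, add_zero, ite_ne_right_iff] at h
        obtain ⟨⟨h2, h3⟩, h4⟩ := h
        obtain ⟨h5, h6⟩ := hs _ _ h4
        have hbw : 1 ≤ b w := by simpa using h2 w
        have hcw := h3 w
        refine ⟨fun v hv => ?_, ?_⟩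
        · have := h5 v hv
          have hvw : w ≠ v := fun h' => hw (h' ▸ hv)
          simpa [Finsupp.single_apply, hvw] using this
        -- A term shifted up from degree b - e_w was not settled before the shift, since otherwise
        -- `b w` would exceed `c w`.
        · rcases h6 with h6 | ⟨-, h6⟩
          · simp at h6
            omega
          · simp at h6
            omega

theorem exists_homologous_supported {k : ℕ} {x : Multichain 𝕜 n} (hx : x ∈ strandPart I c k)
    (hd : koszulD 𝕜 n x = 0) (W : Finset (Fin n)) :
    ∃ y ∈ strandPart I c k, ∃ z ∈ strandPart I c (k + 1), y - x = koszulD 𝕜 n z ∧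
      ∀ b σ, y b σ ≠ 0 → ∀ v ∈ W, v ∉ σ ∧ b v = c v := by
  classical
  induction W using Finset.induction_on with
  | empty => exact ⟨x, hx, 0, Submodule.zero_mem _, by simp, by simp⟩
  | insert w W hw ih =>
    obtain ⟨y, hy, z, hz, hyz, hs⟩ := ih
    have hyd : koszulD 𝕜 n y = 0 := by
      rw [← sub_add_cancel y x, hyz, map_add, koszulD_koszulD, hd, add_zero]
    -- After `c w + 1` pushes, an unsettled term would need a coordinate larger than `c w`, where
    -- the family vanishes.
    obtain ⟨y', hy', z', hz', hyz', hs'⟩ :=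
      exists_homologous_iterate_push W hw hy hyd hs (c w + 1)
    refine ⟨y', hy', z' + z, Submodule.add_mem _ hz' hz, ?_, fun b σ h v hv => ?_⟩
    · rw [map_add, ← hyz, ← hyz', sub_add_sub_cancel]
    · obtain ⟨h1, h2⟩ := hs' b σ h
      rcases Finset.mem_insert.1 hv with rfl | hv
      · refine h2.resolve_left fun h3 => h ?_
        rw [(hy' b).2 fun h4 => by have := h4 v; omega]
        rfl
      · exact h1 v hv

variable (c) in
/-- The augmentation of the strand of degree `c`. -/
noncomputable def strandAugmentation : Multichain 𝕜 n →ₗ[𝕜] 𝕜 :=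
  ∑ b ∈ Finset.Iic c, LinearMap.proj ∅ ∘ₗ LinearMap.proj b

theorem strandAugmentation_apply (x : Multichain 𝕜 n) :
    strandAugmentation c x = ∑ b ∈ Finset.Iic c, x b ∅ := by
  simp [strandAugmentation]

/-- A vertex `v` in degree `b` contributes with the same sign to ∅ in degree `b` through the
boundary and to ∅ in degree b - e_v through the descent; the differential subtracts the two. -/
theorem strandAugmentation_koszulD {x : Multichain 𝕜 n} (hx : x ∈ strand I c) :
    strandAugmentation c (koszulD 𝕜 n x) = 0 := by
  simp only [strandAugmentation_apply, koszulD_apply, Finset.sum_apply, Pi.sub_apply]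
  rw [Finset.sum_comm]
  refine Finset.sum_eq_zero fun v _ => ?_
  rw [Finset.sum_sub_distrib, sub_eq_zero]
  simp only [removeVertex_apply, Finset.notMem_empty, if_false]
  rw [← Finset.mul_sum, ← Finset.mul_sum]
  congr 1
  symm
  -- Degrees outside the image of the shift have `b v = 0`, where {v} is not a face; shifts beyond
  -- `c` meet the zero part of `x`.
  refine Finset.sum_bij_ne_zero (fun a _ _ => a + Finsupp.single v 1) (fun a _ h => ?_)
    (fun a _ _ a' _ _ h => add_right_cancel h) (fun b hb h => ?_) fun _ _ _ => rfl
  · rw [Finset.mem_Iic]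
    by_contra h'
    rw [(hx _).2 h'] at h
    exact h rfl
  · have hv : Finsupp.single v 1 ≤ b := by
      by_contra h'
      exact h ((hx b).1 _ fun h'' => h' (one_le_of_charVec_le (Finset.mem_insert_self v ∅) h''.1))
    refine ⟨b - Finsupp.single v 1, ?_, ?_, tsub_add_cancel_of_le hv⟩
    · exact Finset.mem_Iic.2 (le_trans tsub_le_self (Finset.mem_Iic.1 hb))
    · rwa [tsub_add_cancel_of_le hv]

/-- Pushing along all vertices makes a cycle homologous to one supported on the face ∅ in degree
`c`. Its one coefficient vanishes for cardinality reasons when `k` is positive, and equals the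
augmentation when `k = 0`. -/
theorem strand_exact {k : ℕ} {x : Multichain 𝕜 n} (hx : x ∈ strandPart I c k)
    (hd : koszulD 𝕜 n x = 0) (hε : k = 0 → strandAugmentation c x = 0) :
    ∃ z ∈ strandPart I c (k + 1), koszulD 𝕜 n z = x := by
  obtain ⟨y, hy, z, hz, hyz, hs⟩ := exists_homologous_supported hx hd Finset.univ
  suffices y = 0 by
    refine ⟨-z, Submodule.neg_mem _ hz, ?_⟩
    rw [map_neg, ← hyz, this, zero_sub, neg_neg]
  have hs' (b : Fin n →₀ ℕ) (σ : Finset (Fin n)) (h : y b σ ≠ 0) : b = c ∧ σ = ∅ :=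
    ⟨Finsupp.ext fun v => (hs b σ h v (Finset.mem_univ v)).2,
      Finset.eq_empty_of_forall_notMem fun v => (hs b σ h v (Finset.mem_univ v)).1⟩
  funext b σ
  by_contra h
  obtain ⟨rfl, rfl⟩ := hs' b σ h
  have hk : k = 0 := by
    by_contra hk
    exact h ((hy b).1 ∅ fun h' => hk h'.2.symm)
  have h0 : strandAugmentation b y = 0 := by
    rw [← sub_add_cancel y x, hyz, map_add,
      strandAugmentation_koszulD (strandPart_le_strand _ hz), hε hk, add_zero]
  rw [strandAugmentation_apply, Finset.sum_eq_single b _ (by simp)] at h0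
  · exact h h0
  · intro b' _ hb'
    by_contra h'
    exact hb' (hs' b' ∅ h').1

end Strand

/-! ### Homological perturbation -/

section Perturbation

variable {R : Type*} [Ring R] {d p h A : R}

theorem mul_resolvent_eq (hA : (1 - h * p) * A = 1) : A = 1 + h * p * A := by
  rw [sub_mul, one_mul] at hA
  exact sub_eq_iff_eq_add.1 hA

theorem resolvent_mul_eq (hA : A * (1 - h * p) = 1) : A = 1 + A * (h * p) := by
  rw [mul_sub, mul_one] at hA
  exact sub_eq_iff_eq_add.1 hA

theorem isIdempotent_harmonic (dd : d * d = 0) (hh : h * h = 0) (dhd : d * h * d = d)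
    (hdh : h * d * h = h) :
    (1 - d * h - h * d) * (1 - d * h - h * d) = 1 - d * h - h * d := by
  have e : (1 - d * h - h * d) * (1 - d * h - h * d) =
      1 - d * h - h * d - d * h - h * d + (d * h * d) * h + d * (h * h) * d + h * (d * d) * h +
        (h * d * h) * d := by noncomm_ring
  rw [e, dhd, hdh, hh, dd]
  noncomm_ring

/-- With π = 1 - dh - hd, the perturbed inclusion Aπ intertwines the transferred differential -πpAπ
with d - p. -/
theorem perturbed_inclusion (dd : d * d = 0) (pp : p * p = 0) (dp : d * p + p * d = 0)
    (dhd : d * h * d = d) (hA : (1 - h * p) * A = 1) (hA' : A * (1 - h * p) = 1) :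
    (d - p) * A * (1 - d * h - h * d) =
      -(A * ((1 - d * h - h * d) * p * A * (1 - d * h - h * d))) := by
  set π := 1 - d * h - h * d with hπ
  have dπ : d * π = 0 := by
    have : d * π = d - (d * d) * h - d * h * d := by rw [hπ]; noncomm_ring
    rw [this, dd, dhd]; simp
  have dp' : d * p = -(p * d) := eq_neg_of_add_eq_zero_left dp
  have dh : d * h = 1 - π - h * d := by rw [hπ]; abel
  have h1 : (d - p) * A * π = -(π * p * A * π) + h * p * d * A * π := by
    have e : d * A * π = d * π + (d * h) * p * A * π := by
      conv_lhs => rw [mul_resolvent_eq hA]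
      noncomm_ring
    rw [sub_mul, sub_mul, e, dπ, dh]
    have e2 : (1 - π - h * d) * p * A * π =
        p * A * π - π * p * A * π - h * (d * p) * A * π := by noncomm_ring
    rw [e2, dp']
    noncomm_ring
  have h2 : h * p * ((d - p) * A * π) = h * p * d * A * π := by
    have e : h * p * ((d - p) * A * π) = h * p * d * A * π - h * (p * p) * A * π := by noncomm_ring
    rw [e, pp]; simp
  -- It suffices to compare after multiplication by the invertible element `1 - h * p`, which
  -- removes the leading `A`.
  have h3 : (1 - h * p) * ((d - p) * A * π) = -(π * p * A * π) := by
    rw [sub_mul, one_mul, h2, h1]; abel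
  rw [← one_mul ((d - p) * A * π), ← hA', mul_assoc, h3, mul_neg]

/-- This mirrors the inclusion: 1 + pAh is a right inverse of 1 - ph, so the comparison is made
after multiplying by 1 - ph on the right. -/
theorem perturbed_projection (dd : d * d = 0) (pp : p * p = 0) (dp : d * p + p * d = 0)
    (dhd : d * h * d = d) (hA : (1 - h * p) * A = 1) (hA' : A * (1 - h * p) = 1) :
    (1 - d * h - h * d) * (1 + p * A * h) * (d - p) =
      -((1 - d * h - h * d) * p * A * (1 - d * h - h * d) * (1 + p * A * h)) := by
  set π := 1 - d * h - h * d with hπ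
  set B := 1 + p * A * h with hB
  have B1 : (1 - p * h) * B = 1 := by
    have e : (1 - p * h) * B = 1 - p * h + p * ((1 - h * p) * A) * h := by rw [hB]; noncomm_ring
    rw [e, hA]; noncomm_ring
  have Bp : B * p = p * A := by
    have e : B * p = p * (1 + A * (h * p)) := by rw [hB]; noncomm_ring
    rw [e, ← resolvent_mul_eq hA']
  have Beq : B = 1 + B * p * h := by rw [Bp, hB]
  have πd : π * d = 0 := by
    have : π * d = d - d * h * d - h * (d * d) := by rw [hπ]; noncomm_ring
    rw [this, dd, dhd]; simp
  have dp' : p * d = -(d * p) := eq_neg_of_add_eq_zero_right dp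
  have hd : h * d = 1 - π - d * h := by rw [hπ]; abel
  have h1 : π * B * (d - p) = -(π * B * p * π) + π * B * d * p * h := by
    have e : π * B * d = π * d + π * B * p * (h * d) := by
      conv_lhs => rw [Beq]
      noncomm_ring
    have e2 : π * B * p * (1 - π - d * h) =
        π * B * p - π * B * p * π - π * B * (p * d) * h := by noncomm_ring
    have e3 : π * B * (d * p) * h = π * B * d * p * h := by noncomm_ring
    rw [πd, hd, e2, dp', mul_neg, neg_mul, e3] at e
    rw [mul_sub]
    conv_lhs => rw [e]
    abel
  have h2 : π * B * (d - p) * (p * h) = π * B * d * p * h := by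
    have e : π * B * (d - p) * (p * h) = π * B * d * p * h - π * B * (p * p) * h := by noncomm_ring
    rw [e, pp]; simp
  have h3 : π * B * (d - p) * (1 - p * h) = -(π * B * p * π) := by
    rw [mul_sub, mul_one, h2, h1]; abel
  rw [← mul_one (π * B * (d - p)), ← B1, ← mul_assoc, h3, mul_assoc π B p, Bp]
  noncomm_ring

/-- The side conditions give hA = h, πA = π and hπ = 0, so both corrections disappear. Thus the
perturbed projection is a left inverse of the perturbed inclusion on the image of π. -/
theorem perturbed_retraction (dd : d * d = 0) (hh : h * h = 0) (dhd : d * h * d = d)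
    (hdh : h * d * h = h) (hA : (1 - h * p) * A = 1) :
    (1 - d * h - h * d) * (1 + p * A * h) * A * (1 - d * h - h * d) = 1 - d * h - h * d := by
  have hA0 : h * A = h := by
    rw [mul_resolvent_eq hA]
    have e : h * (1 + h * p * A) = h + (h * h) * p * A := by noncomm_ring
    rw [e, hh]; simp
  have hπ : h * (1 - d * h - h * d) = 0 := by
    have e : h * (1 - d * h - h * d) = h - h * d * h - (h * h) * d := by noncomm_ring
    rw [e, hdh, hh]; simp
  have πh : (1 - d * h - h * d) * h = 0 := by
    have e : (1 - d * h - h * d) * h = h - d * (h * h) - h * d * h := by noncomm_ring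
    rw [e, hdh, hh]; simp
  have πA : (1 - d * h - h * d) * A = 1 - d * h - h * d := by
    conv_lhs => rw [mul_resolvent_eq hA]
    have e : (1 - d * h - h * d) * (1 + h * p * A) =
      1 - d * h - h * d + (1 - d * h - h * d) * h * p * A := by noncomm_ring
    rw [e, πh]; simp
  have e : (1 - d * h - h * d) * (1 + p * A * h) * A * (1 - d * h - h * d) =
      (1 - d * h - h * d) * A * (1 - d * h - h * d) +
      (1 - d * h - h * d) * p * A * ((h * A) * (1 - d * h - h * d)) := by noncomm_ring
  rw [e, hA0, hπ, πA, isIdempotent_harmonic dd hh dhd hdh]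
  simp

/-- The intertwining relation carries (d - p)² = 0 over to the transferred differential, since `A`
can be cancelled. -/
theorem perturbed_transfer_mul_self (dd : d * d = 0) (pp : p * p = 0) (dp : d * p + p * d = 0)
    (hh : h * h = 0) (dhd : d * h * d = d) (hdh : h * d * h = h) (hA : (1 - h * p) * A = 1)
    (hA' : A * (1 - h * p) = 1) :
    (1 - d * h - h * d) * p * A * (1 - d * h - h * d) *
      ((1 - d * h - h * d) * p * A * (1 - d * h - h * d)) = 0 := by
  have h1 := perturbed_inclusion dd pp dp dhd hA hA'
  have ππ := isIdempotent_harmonic dd hh dhd hdh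
  set π := 1 - d * h - h * d with hπ
  have hD : (d - p) * (d - p) = 0 := by
    have : (d - p) * (d - p) = d * d - (d * p + p * d) + p * p := by noncomm_ring
    rw [this, dd, pp, dp]; simp
  have e : π * p * A * π * (π * p * A * π) = π * p * A * π * (p * A * π) := by
    have : π * p * A * π * (π * p * A * π) = π * p * A * (π * π) * (p * A * π) := by noncomm_ring
    rw [this, ππ]
  have h2 : A * (π * p * A * π * (p * A * π)) = 0 := by
    have e1 : A * (π * p * A * π * (p * A * π)) = A * (π * p * A * π) * (p * A * π) := by
      noncomm_ring
    have e2 : (d - p) * A * π * (p * A * π) = (d - p) * (A * (π * p * A * π)) := by noncomm_ring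
    rw [e1, ← neg_neg (A * (π * p * A * π)), ← h1, neg_mul, e2,
      ← neg_neg (A * (π * p * A * π)), ← h1, mul_neg, neg_neg]
    have e3 : (d - p) * ((d - p) * A * π) = (d - p) * (d - p) * A * π := by noncomm_ring
    rw [e3, hD]; simp
  rw [e, ← one_mul (π * p * A * π * (p * A * π)), ← hA, mul_assoc, h2, mul_zero]

end Perturbation

/-! ### Transfer of the Koszul differential to harmonic families. -/

section Transfer

variable {𝕜 : Type*} [Field 𝕜] {n : ℕ} {I : Ideal (MvPolynomial (Fin n) 𝕜)}
  (𝒞 : ∀ b, Community 𝕜 (koszul I b)) {c : Fin n →₀ ℕ}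

/-- The shrub map in each degree. -/
noncomputable def levelShrub : Module.End 𝕜 (Multichain 𝕜 n) := degreewise fun b => shrubMap (𝒞 b)

variable (c) in
/-- The geometric series of the shrub map after the descent. -/
noncomputable def resolvent : Module.End 𝕜 (Multichain 𝕜 n) :=
  ∑ m ∈ Finset.range (c.degree + 1), (levelShrub 𝒞 * descent 𝕜 n) ^ m

variable (c) in
/-- The transferred differential. -/
noncomputable def transfer : Module.End 𝕜 (Multichain 𝕜 n) :=
  (1 - levelBoundary 𝕜 n * levelShrub 𝒞 - levelShrub 𝒞 * levelBoundary 𝕜 n) * descent 𝕜 n *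
    resolvent 𝒞 c

/-- A family of chains is harmonic if the boundary and the shrub map vanish on it. -/
def IsHarmonic (x : Multichain 𝕜 n) : Prop := levelBoundary 𝕜 n x = 0 ∧ levelShrub 𝒞 x = 0

variable {𝒞}

theorem levelShrub_apply (x : Multichain 𝕜 n) (b : Fin n →₀ ℕ) :
    levelShrub 𝒞 x b = shrubMap (𝒞 b) (x b) := rfl

theorem levelShrub_mem_strandPart {k : ℕ} {x : Multichain 𝕜 n} (hx : x ∈ strandPart I c k) :
    levelShrub 𝒞 x ∈ strandPart I c (k + 1) :=
  degreewise_mem (fun _ _ => shrubMap_mem_chains) hx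

theorem levelShrub_mem_strand {x : Multichain 𝕜 n} (hx : x ∈ strand I c) :
    levelShrub 𝒞 x ∈ strand I c := by
  refine degreewise_mem (F' := fun b => {τ | τ ∈ koszul I b}) (fun b _ h => ?_) hx
  refine map_mem_of_facesSpan (fun τ hτ => ?_) h
  exact facesSpan_mono (fun _ h => h.1)
    (shrubMap_mem_chains (𝒞 := 𝒞 b) (k := τ.card) (single_mem_facesSpan ⟨hτ, rfl⟩))

/-- An identity between linear maps on `strand I c` holds if it holds on all homogeneous chains in
each degree. -/
theorem degreewise_eqOn_strand {f g : (Fin n →₀ ℕ) → Chain 𝕜 n →ₗ[𝕜] Chain 𝕜 n}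
    (h : ∀ b k, ∀ x ∈ chains 𝕜 (koszul I b) k, f b x = g b x) {x : Multichain 𝕜 n}
    (hx : x ∈ strand I c) : degreewise f x = degreewise g x :=
  funext fun b => eqOn_facesSpan (fun τ hτ => h b τ.card _ (single_mem_facesSpan ⟨hτ, rfl⟩))
    (hx b).1

theorem levelShrub_levelShrub {x : Multichain 𝕜 n} (hx : x ∈ strand I c) :
    levelShrub 𝒞 (levelShrub 𝒞 x) = 0 :=
  degreewise_eqOn_strand (f := fun b => shrubMap (𝒞 b) ∘ₗ shrubMap (𝒞 b)) (g := 0)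
    (fun _ _ _ => shrubMap_shrubMap) hx

theorem levelBoundary_levelShrub_levelBoundary {x : Multichain 𝕜 n} (hx : x ∈ strand I c) :
    levelBoundary 𝕜 n (levelShrub 𝒞 (levelBoundary 𝕜 n x)) = levelBoundary 𝕜 n x :=
  degreewise_eqOn_strand (f := fun b => boundary 𝕜 ∘ₗ shrubMap (𝒞 b) ∘ₗ boundary 𝕜)
    (g := fun _ => boundary 𝕜) (fun _ _ _ => boundary_shrubMap_boundary) hx

theorem levelShrub_levelBoundary_levelShrub {x : Multichain 𝕜 n} (hx : x ∈ strand I c) :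
    levelShrub 𝒞 (levelBoundary 𝕜 n (levelShrub 𝒞 x)) = levelShrub 𝒞 x :=
  degreewise_eqOn_strand (f := fun b => shrubMap (𝒞 b) ∘ₗ boundary 𝕜 ∘ₗ shrubMap (𝒞 b))
    (g := fun b => shrubMap (𝒞 b)) (fun _ _ _ => shrubMap_boundary_shrubMap) hx

/-- Each factor reads its argument one total degree higher, and `x` lives in degrees below `c`. This
nilpotency makes the geometric series an inverse. -/
theorem pow_apply_eq_zero {x : Multichain 𝕜 n} (hx : x ∈ strand I c) (m : ℕ) (a : Fin n →₀ ℕ)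
    (ha : c.degree < a.degree + m) : ((levelShrub 𝒞 * descent 𝕜 n) ^ m) x a = 0 := by
  induction m generalizing a with
  | zero => exact (hx a).2 fun h => by have := Finsupp.degree_mono h; omega
  | succ m ih =>
    rw [pow_succ', Module.End.mul_apply, Module.End.mul_apply, levelShrub_apply, descent_apply,
      Finset.sum_eq_zero, map_zero]
    intro v _
    rw [ih, map_zero]
    rw [map_add, Finsupp.degree_single]
    omega

theorem pow_eq_zero_on_strand {x : Multichain 𝕜 n} (hx : x ∈ strand I c) :
    ((levelShrub 𝒞 * descent 𝕜 n) ^ (c.degree + 1)) x = 0 :=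
  funext fun a => pow_apply_eq_zero hx _ a (by omega)

theorem one_sub_mul_resolvent {x : Multichain 𝕜 n} (hx : x ∈ strand I c) :
    ((1 - levelShrub 𝒞 * descent 𝕜 n) * resolvent 𝒞 c) x = x := by
  rw [resolvent, mul_neg_geom_sum, LinearMap.sub_apply, pow_eq_zero_on_strand hx,
    Module.End.one_apply, sub_zero]

theorem resolvent_mul_one_sub {x : Multichain 𝕜 n} (hx : x ∈ strand I c) :
    (resolvent 𝒞 c * (1 - levelShrub 𝒞 * descent 𝕜 n)) x = x := by
  rw [resolvent, geom_sum_mul_neg, LinearMap.sub_apply, pow_eq_zero_on_strand hx,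
    Module.End.one_apply, sub_zero]

theorem pow_mem_strandPart {k : ℕ} {x : Multichain 𝕜 n} (hx : x ∈ strandPart I c k) (m : ℕ) :
    ((levelShrub 𝒞 * descent 𝕜 n) ^ m) x ∈ strandPart I c k := by
  induction m with
  | zero => exact hx
  | succ m ih =>
    rw [pow_succ', Module.End.mul_apply, Module.End.mul_apply]
    cases k with
    | zero =>
      rw [descent_eq_zero ih, map_zero]
      exact Submodule.zero_mem _
    | succ k => exact levelShrub_mem_strandPart (descent_mem_strandPart ih)

theorem pow_mem_strand {x : Multichain 𝕜 n} (hx : x ∈ strand I c) (m : ℕ) :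
    ((levelShrub 𝒞 * descent 𝕜 n) ^ m) x ∈ strand I c := by
  induction m with
  | zero => exact hx
  | succ m ih =>
    rw [pow_succ', Module.End.mul_apply, Module.End.mul_apply]
    exact levelShrub_mem_strand (descent_mem_strand ih)

theorem resolvent_mem_strandPart {k : ℕ} {x : Multichain 𝕜 n} (hx : x ∈ strandPart I c k) :
    resolvent 𝒞 c x ∈ strandPart I c k := by
  rw [resolvent, LinearMap.sum_apply]
  exact Submodule.sum_mem _ fun m _ => pow_mem_strandPart hx m

theorem resolvent_mem_strand {x : Multichain 𝕜 n} (hx : x ∈ strand I c) :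
    resolvent 𝒞 c x ∈ strand I c := by
  rw [resolvent, LinearMap.sum_apply]
  exact Submodule.sum_mem _ fun m _ => pow_mem_strand hx m

variable (𝒞) in
/-- The projection onto the harmonic families. -/
noncomputable def harmonicProj : Module.End 𝕜 (Multichain 𝕜 n) :=
  1 - levelBoundary 𝕜 n * levelShrub 𝒞 - levelShrub 𝒞 * levelBoundary 𝕜 n

theorem harmonicProj_apply (x : Multichain 𝕜 n) : harmonicProj 𝒞 x =
    x - levelBoundary 𝕜 n (levelShrub 𝒞 x) - levelShrub 𝒞 (levelBoundary 𝕜 n x) := rfl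

theorem transfer_apply (x : Multichain 𝕜 n) :
    transfer 𝒞 c x = harmonicProj 𝒞 (descent 𝕜 n (resolvent 𝒞 c x)) := rfl

theorem harmonicProj_mem_strandPart {k : ℕ} {x : Multichain 𝕜 n} (hx : x ∈ strandPart I c k) :
    harmonicProj 𝒞 x ∈ strandPart I c k := by
  rw [harmonicProj_apply]
  refine Submodule.sub_mem _ (Submodule.sub_mem _ hx
    (levelBoundary_mem_strandPart (levelShrub_mem_strandPart hx))) ?_
  cases k with
  | zero =>
    rw [levelBoundary_eq_zero hx, map_zero]
    exact Submodule.zero_mem _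
  | succ k => exact levelShrub_mem_strandPart (levelBoundary_mem_strandPart hx)

theorem transfer_mem_strandPart {k : ℕ} {x : Multichain 𝕜 n} (hx : x ∈ strandPart I c (k + 1)) :
    transfer 𝒞 c x ∈ strandPart I c k := by
  rw [transfer_apply]
  exact harmonicProj_mem_strandPart (descent_mem_strandPart (resolvent_mem_strandPart hx))

theorem harmonicProj_of_isHarmonic {x : Multichain 𝕜 n} (hx : IsHarmonic 𝒞 x) :
    harmonicProj 𝒞 x = x := by
  rw [harmonicProj_apply, hx.1, hx.2]
  simp

theorem isHarmonic_harmonicProj {x : Multichain 𝕜 n} (hx : x ∈ strand I c) :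
    IsHarmonic 𝒞 (harmonicProj 𝒞 x) := by
  have dd : levelBoundary 𝕜 n (levelBoundary 𝕜 n (levelShrub 𝒞 x)) = 0 :=
    LinearMap.congr_fun levelBoundary_mul_self _
  rw [IsHarmonic, harmonicProj_apply]
  constructor
  · rw [map_sub, map_sub, levelBoundary_levelShrub_levelBoundary hx, dd]
    simp
  · rw [map_sub, map_sub, levelShrub_levelBoundary_levelShrub hx,
      levelShrub_levelShrub (levelBoundary_mem_strand hx)]
    simp

theorem isHarmonic_transfer {x : Multichain 𝕜 n} (hx : x ∈ strand I c) :
    IsHarmonic 𝒞 (transfer 𝒞 c x) :=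
  isHarmonic_harmonicProj (descent_mem_strand (resolvent_mem_strand hx))

variable (𝒞 c) in
/-- The differentials and homotopies on the strand satisfy the hypotheses of homological
perturbation theory. -/
theorem exists_strand_operators : ∃ d p h A : Module.End 𝕜 (strand I c),
    (∀ x, (d x : Multichain 𝕜 n) = levelBoundary 𝕜 n x) ∧
    (∀ x, (p x : Multichain 𝕜 n) = descent 𝕜 n x) ∧
    (∀ x, (h x : Multichain 𝕜 n) = levelShrub 𝒞 x) ∧
    (∀ x, (A x : Multichain 𝕜 n) = resolvent 𝒞 c x) ∧
    d * d = 0 ∧ p * p = 0 ∧ d * p + p * d = 0 ∧ h * h = 0 ∧ d * h * d = d ∧ h * d * h = h ∧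
    (1 - h * p) * A = 1 ∧ A * (1 - h * p) = 1 := by
  refine ⟨(levelBoundary 𝕜 n).restrict fun _ => levelBoundary_mem_strand,
    (descent 𝕜 n).restrict fun _ => descent_mem_strand,
    (levelShrub 𝒞).restrict fun _ => levelShrub_mem_strand,
    (resolvent 𝒞 c).restrict fun _ => resolvent_mem_strand, fun _ => rfl, fun _ => rfl,
    fun _ => rfl, fun _ => rfl, ?_, ?_, ?_, ?_, ?_, ?_, ?_, ?_⟩ <;>
    refine LinearMap.ext fun x => Subtype.ext ?_
  · exact LinearMap.congr_fun levelBoundary_mul_self _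
  · exact LinearMap.congr_fun descent_mul_self _
  · exact LinearMap.congr_fun levelBoundary_descent _
  · exact levelShrub_levelShrub x.2
  · exact levelBoundary_levelShrub_levelBoundary x.2
  · exact levelShrub_levelBoundary_levelShrub x.2
  · exact one_sub_mul_resolvent x.2
  · exact resolvent_mul_one_sub x.2

theorem transfer_transfer {x : Multichain 𝕜 n} (hx : x ∈ strand I c) (hxh : IsHarmonic 𝒞 x) :
    transfer 𝒞 c (transfer 𝒞 c x) = 0 := by
  obtain ⟨d, p, h, A, hd, hp, hh, hA, h1, h2, h3, h4, h5, h6, h7, h8⟩ :=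
    exists_strand_operators 𝒞 c
  have key := congrArg (fun f : Module.End 𝕜 (strand I c) => (f ⟨x, hx⟩ : Multichain 𝕜 n))
    (perturbed_transfer_mul_self h1 h2 h3 h4 h5 h6 h7 h8)
  have hπ (y : strand I c) :
      ((1 - d * h - h * d) y : Multichain 𝕜 n) = harmonicProj 𝒞 (y : Multichain 𝕜 n) := by
    simp [harmonicProj_apply, hd, hh]
  simpa only [Module.End.mul_apply, hπ, hp, hA, harmonicProj_of_isHarmonic hxh, ← transfer_apply,
    harmonicProj_of_isHarmonic (isHarmonic_transfer hx), LinearMap.zero_apply,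
    Submodule.coe_zero] using key

theorem koszulD_resolvent {x : Multichain 𝕜 n} (hx : x ∈ strand I c) (hxh : IsHarmonic 𝒞 x) :
    koszulD 𝕜 n (resolvent 𝒞 c x) = -resolvent 𝒞 c (transfer 𝒞 c x) := by
  obtain ⟨d, p, h, A, hd, hp, hh, hA, h1, h2, h3, h4, h5, h6, h7, h8⟩ :=
    exists_strand_operators 𝒞 c
  have key := congrArg (fun f : Module.End 𝕜 (strand I c) => (f ⟨x, hx⟩ : Multichain 𝕜 n))
    (perturbed_inclusion h1 h2 h3 h5 h7 h8)
  have hπ (y : strand I c) :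
      ((1 - d * h - h * d) y : Multichain 𝕜 n) = harmonicProj 𝒞 (y : Multichain 𝕜 n) := by
    simp [harmonicProj_apply, hd, hh]
  have hD (y : strand I c) : ((d - p) y : Multichain 𝕜 n) = koszulD 𝕜 n y := by
    simp [koszulD, hd, hp]
  simpa only [Module.End.mul_apply, hπ, hp, hA, hD, harmonicProj_of_isHarmonic hxh,
    ← transfer_apply, LinearMap.neg_apply, Submodule.coe_neg] using key

theorem resolvent_of_mem_strandPart_zero {x : Multichain 𝕜 n} (hx : x ∈ strandPart I c 0) :
    resolvent 𝒞 c x = x := by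
  have := resolvent_mul_one_sub (𝒞 := 𝒞) (strandPart_le_strand 0 hx)
  rwa [Module.End.mul_apply, LinearMap.sub_apply, Module.End.mul_apply, descent_eq_zero hx,
    map_zero, sub_zero] at this

/-- In the lowest part the resolvent is the identity, so the transfer of `x` is up to sign a Koszul
boundary, on which the augmentation vanishes. -/
theorem strandAugmentation_transfer {x : Multichain 𝕜 n} (hx : x ∈ strandPart I c 1)
    (hxh : IsHarmonic 𝒞 x) : strandAugmentation c (transfer 𝒞 c x) = 0 := by
  have h1 := koszulD_resolvent (strandPart_le_strand 1 hx) hxh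
  rw [resolvent_of_mem_strandPart_zero (transfer_mem_strandPart hx), eq_neg_iff_add_eq_zero,
    add_comm, ← eq_neg_iff_add_eq_zero] at h1
  rw [h1, map_neg, strandAugmentation_koszulD
    (resolvent_mem_strand (strandPart_le_strand 1 hx)), neg_zero]

/-- The perturbed inclusion turns `x` into a Koszul cycle, which bounds some `z` by `strand_exact`.
The perturbed projection of `z`, up to sign, then has transfer `x` because of the retraction
identity. -/
theorem transfer_exact {k : ℕ} {x : Multichain 𝕜 n} (hx : x ∈ strandPart I c k)
    (hxh : IsHarmonic 𝒞 x) (h0 : transfer 𝒞 c x = 0)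
    (hε : k = 0 → strandAugmentation c x = 0) :
    ∃ w ∈ strandPart I c (k + 1), IsHarmonic 𝒞 w ∧ transfer 𝒞 c w = x := by
  have hxs := strandPart_le_strand k hx
  obtain ⟨z, hz, hzx⟩ := strand_exact (resolvent_mem_strandPart (𝒞 := 𝒞) hx)
    (by rw [koszulD_resolvent hxs hxh, h0, map_zero, neg_zero]) (by
      rintro rfl
      rw [resolvent_of_mem_strandPart_zero hx, hε rfl])
  have hzs := strandPart_le_strand _ hz
  obtain ⟨d, p, h, A, hd, hp, hh, hA, h1, h2, h3, h4, h5, h6, h7, h8⟩ :=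
    exists_strand_operators 𝒞 c
  have hπ (y : strand I c) :
      ((1 - d * h - h * d) y : Multichain 𝕜 n) = harmonicProj 𝒞 (y : Multichain 𝕜 n) := by
    simp [harmonicProj_apply, hd, hh]
  have key1 := congrArg (fun f : Module.End 𝕜 (strand I c) => (f ⟨z, hzs⟩ : Multichain 𝕜 n))
    (perturbed_projection h1 h2 h3 h5 h7 h8)
  have key2 := congrArg (fun f : Module.End 𝕜 (strand I c) => (f ⟨x, hxs⟩ : Multichain 𝕜 n))
    (perturbed_retraction h1 h4 h5 h6 h7)
  have hB : z + descent 𝕜 n (resolvent 𝒞 c (levelShrub 𝒞 z)) ∈ strandPart I c (k + 1) :=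
    Submodule.add_mem _ hz (descent_mem_strandPart
      (resolvent_mem_strandPart (levelShrub_mem_strandPart hz)))
  refine ⟨-harmonicProj 𝒞 (z + descent 𝕜 n (resolvent 𝒞 c (levelShrub 𝒞 z))),
    Submodule.neg_mem _ (harmonicProj_mem_strandPart hB), ?_, ?_⟩
  · have := isHarmonic_harmonicProj (𝒞 := 𝒞) (strandPart_le_strand _ hB)
    exact ⟨by rw [map_neg, this.1, neg_zero], by rw [map_neg, this.2, neg_zero]⟩
  · have hD : ((d - p) ⟨z, hzs⟩ : strand I c) = A ⟨x, hxs⟩ := by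
      refine Subtype.ext ?_
      rw [hA, ← hzx]
      simp [koszulD, hd, hp]
    rw [map_neg, transfer_apply]
    simp only [Module.End.mul_apply, hD, LinearMap.neg_apply, hπ, Submodule.coe_neg, hp, hA,
      LinearMap.add_apply, Module.End.one_apply, Submodule.coe_add, hh,
      harmonicProj_of_isHarmonic hxh] at key1 key2
    rw [← key1, key2]

end Transfer

/-! ### Fences and the transferred differential -/

section Walks

variable {𝕜 : Type*} [Field 𝕜] {n : ℕ}

/-- Alternately removing the vertices `p 0, …, p m` and applying the maps `H 0, …, H (m - 1)`. -/
noncomputable def walk : (m : ℕ) → (Fin m → Chain 𝕜 n →ₗ[𝕜] Chain 𝕜 n) → (Fin (m + 1) → Fin n) →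
    Chain 𝕜 n →ₗ[𝕜] Chain 𝕜 n
  | 0, _, p => removeVertex (p 0)
  | m + 1, H, p => removeVertex (p (Fin.last (m + 1))) ∘ₗ H (Fin.last m) ∘ₗ
      walk m (fun j => H j.castSucc) (fun j => p j.castSucc)

theorem walk_succ (m : ℕ) (H : Fin (m + 1) → Chain 𝕜 n →ₗ[𝕜] Chain 𝕜 n)
    (p : Fin (m + 2) → Fin n) : walk (m + 1) H p = removeVertex (p (Fin.last (m + 1))) ∘ₗ
      H (Fin.last m) ∘ₗ walk m (fun j => H j.castSucc) (fun j => p j.castSucc) := rfl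

theorem apply_removeVertex (L : Chain 𝕜 n →ₗ[𝕜] 𝕜) (v : Fin n) (x : Chain 𝕜 n) :
    L (removeVertex v x) =
      ∑ τ, x τ * (if v ∈ τ then facetSign 𝕜 v τ else 0) * L (Pi.single (τ.erase v) 1) := by
  conv_lhs => rw [chain_eq_sum x, map_sum, map_sum]
  refine Finset.sum_congr rfl fun τ _ => ?_
  rw [map_smul, map_smul, removeVertex_single]
  split_ifs <;> simp [mul_assoc]

/-- This expands a product of matrices over all sequences of intermediate faces. The functional `L`
is arbitrary so that the induction can absorb the last step into it. -/
theorem apply_walk (m : ℕ) (H : Fin m → Chain 𝕜 n →ₗ[𝕜] Chain 𝕜 n) (p : Fin (m + 1) → Fin n)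
    (L : Chain 𝕜 n →ₗ[𝕜] 𝕜) (x : Chain 𝕜 n) :
    L (walk m H p x) = ∑ u : Fin (m + 1) → Finset (Fin n), x (u 0) *
      (∏ j : Fin m, H j (Pi.single ((u j.castSucc).erase (p j.castSucc)) 1) (u j.succ)) *
      (∏ j, if p j ∈ u j then facetSign 𝕜 (p j) (u j) else 0) *
      L (Pi.single ((u (Fin.last m)).erase (p (Fin.last m))) 1) := by
  induction m generalizing L with
  | zero =>
    rw [walk, apply_removeVertex]
    refine Fintype.sum_equiv (Equiv.funUnique (Fin 1) (Finset (Fin n))).symm _ _ fun τ => ?_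
    simp
  | succ m ih =>
    have h := ih (fun j => H j.castSucc) (fun j => p j.castSucc)
      (L ∘ₗ removeVertex (p (Fin.last (m + 1))) ∘ₗ H (Fin.last m))
    simp only [LinearMap.comp_apply] at h
    rw [walk, LinearMap.comp_apply, LinearMap.comp_apply, h]
    simp only [apply_removeVertex, Finset.mul_sum]
    rw [Finset.sum_comm, ← Finset.sum_product', Finset.univ_product_univ]
    refine Fintype.sum_equiv (Fin.snocEquiv fun _ => Finset (Fin n)) _ _ fun q => ?_
    obtain ⟨t, u⟩ := q
    simp only [Fin.snocEquiv_apply, Fin.prod_univ_castSucc, Fin.snoc_castSucc, Fin.snoc_last,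
      Fin.succ_last, ← Fin.castSucc_succ]
    have h0 : (Fin.snoc u t : Fin (m + 2) → Finset (Fin n)) 0 = u 0 :=
      Fin.snoc_castSucc (α := fun _ => Finset (Fin n)) t u 0
    rw [h0]
    ring

theorem mem_latticePaths {m : ℕ} {a b : Fin n →₀ ℕ} {p : Fin (m + 1) → Fin n} :
    p ∈ latticePaths m a b ↔ a + ∑ j, Finsupp.single (p j) 1 = b := by
  simp [latticePaths]

theorem le_of_mem_latticePaths {m : ℕ} {a b : Fin n →₀ ℕ} {p : Fin (m + 1) → Fin n}
    (h : p ∈ latticePaths m a b) : a ≤ b := by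
  rw [← mem_latticePaths.1 h]
  exact self_le_add_right _ _

theorem degree_of_mem_latticePaths {m : ℕ} {a b : Fin n →₀ ℕ} {p : Fin (m + 1) → Fin n}
    (h : p ∈ latticePaths m a b) : b.degree = a.degree + (m + 1) := by
  rw [← mem_latticePaths.1 h, map_add, map_sum]
  simp

theorem node_zero {m : ℕ} (b : Fin n →₀ ℕ) (p : Fin (m + 1) → Fin n) : node b p 0 = b := by
  simp [node]

theorem node_last {m : ℕ} {a b : Fin n →₀ ℕ} {p : Fin (m + 1) → Fin n}
    (h : p ∈ latticePaths m a b) : node b p (m + 1) = a := by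
  rw [node, Finset.filter_true_of_mem fun i _ => i.2, ← mem_latticePaths.1 h,
    add_tsub_cancel_right]

theorem node_eq_node_succ_add {m : ℕ} {a b : Fin n →₀ ℕ} {p : Fin (m + 1) → Fin n}
    (h : p ∈ latticePaths m a b) (j : Fin (m + 1)) :
    node b p j = node b p (j + 1) + Finsupp.single (p j) 1 := by
  have hfil : (Finset.univ.filter fun i : Fin (m + 1) => i.val < j.val + 1) =
      insert j (Finset.univ.filter fun i : Fin (m + 1) => i.val < j.val) := by
    ext i
    simp [Fin.ext_iff]
    omega
  -- Subtraction of exponents is truncated; nothing is lost here because even the full sum of steps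
  -- stays below `b`.
  have hle : Finsupp.single (p j) 1 + ∑ i with i.val < j.val, Finsupp.single (p i) 1 ≤ b := by
    rw [← Finset.sum_insert (f := fun i => Finsupp.single (p i) 1) (a := j) (by simp), ← hfil, ← mem_latticePaths.1 h]
    exact le_trans (Finset.sum_le_sum_of_subset (Finset.filter_subset _ _)) (self_le_add_left _ _)
  rw [node, node, hfil, Finset.sum_insert (by simp), add_comm (Finsupp.single (p j) 1), ← tsub_tsub,
    tsub_add_cancel_of_le]
  exact le_tsub_of_add_le_right hle

theorem node_snoc {m : ℕ} (b : Fin n →₀ ℕ) (p : Fin (m + 1) → Fin n) (v : Fin n) {j : ℕ}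
    (hj : j ≤ m + 1) : node b (Fin.snoc p v : Fin (m + 2) → Fin n) j = node b p j := by
  rw [node, node, Finset.sum_filter, Finset.sum_filter, Fin.sum_univ_castSucc]
  simp [hj.not_gt]

end Walks

/-! ### Sums over fences as compositions of linear maps. -/

section FenceSum

variable {𝕜 : Type*} [Field 𝕜] {n : ℕ} {I : Ideal (MvPolynomial (Fin n) 𝕜)}
  (𝒞 : ∀ b, Community 𝕜 (koszul I b))

/-- The walk along the lattice path `p` that starts in `b`. -/
noncomputable def pathWalk {m : ℕ} (b : Fin n →₀ ℕ) (p : Fin (m + 1) → Fin n) :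
    Chain 𝕜 n →ₗ[𝕜] Chain 𝕜 n :=
  walk m (fun j => shrubMap (𝒞 (node b p (j + 1)))) p

/-- The sum over all fences along a lattice path is given by composing linear maps. -/
theorem sum_simpleWeight {m i : ℕ} {a b : Fin n →₀ ℕ} {p : Fin (m + 1) → Fin n}
    (hp : p ∈ latticePaths m a b) {τ : Finset (Fin n)} (hτ : τ ∈ faces (koszul I b) (i + 1))
    (σ : Finset (Fin n)) [DecidablePred (IsFence 𝒞 i a b p σ τ)] :
    ∑ φ : FenceData m n with IsFence 𝒞 i a b p σ τ φ, simpleWeight 𝒞 i a b p σ τ φ =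
      circuitMap (𝒞 a) (pathWalk 𝒞 b p (rimMap (𝒞 b) (Pi.single τ 1))) σ := by
  have key := apply_walk m (fun j => shrubMap (𝒞 (node b p (j + 1)))) p
    (LinearMap.proj σ ∘ₗ circuitMap (𝒞 a)) (rimMap (𝒞 b) (Pi.single τ 1))
  simp only [LinearMap.comp_apply, LinearMap.proj_apply] at key
  rw [pathWalk, key]
  have hweight (φ : FenceData m n) (hf : ∀ j, p j ∈ φ.upper j ∧ φ.lower j = (φ.upper j).erase (p j))
      (hl : ∀ j : Fin (m + 1), φ.lower j ∈ faces (koszul I (node b p (j + 1))) i) :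
      simpleWeight 𝒞 i a b p σ τ φ = rimMap (𝒞 b) (Pi.single τ 1) (φ.1 0) *
      (∏ j : Fin m, shrubMap (𝒞 (node b p (j + 1)))
        (Pi.single ((φ.1 j.castSucc).erase (p j.castSucc)) 1) (φ.1 j.succ)) *
      (∏ j, if p j ∈ φ.1 j then facetSign 𝕜 (p j) (φ.1 j) else 0) *
      circuitMap (𝒞 a) (Pi.single ((φ.1 (Fin.last m)).erase (p (Fin.last m))) 1) σ := by
    have hlast := hl (Fin.last m)
    rw [Fin.val_last, node_last hp] at hlast
    rw [simpleWeight, rimCoeff_eq hτ, circuitCoeff_eq hlast, (hf (Fin.last m)).2]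
    congr 2
    · congr 1
      refine Finset.prod_congr rfl fun j _ => ?_
      rw [shrubCoeff_eq (hl j.castSucc).2, (hf j.castSucc).2]
    · exact Finset.prod_congr rfl fun j _ => by rw [if_pos (hf j).1]
  -- A fence is determined by its upper faces. Conversely, a sequence of faces with nonzero product
  -- satisfies all fence conditions, since each coefficient vanishes outside its proper domain.
  refine Finset.sum_bij_ne_zero (fun φ _ _ => φ.1) (fun _ _ _ => Finset.mem_univ _)
    (fun φ hφ _ ψ hψ _ h => ?_) (fun u _ hu => ?_) fun φ hφ _ => ?_
  · refine Prod.ext h (funext fun j => ?_)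
    refine ((Finset.mem_filter.1 hφ).2.facet j).2.trans (Eq.trans ?_
      ((Finset.mem_filter.1 hψ).2.facet j).2.symm)
    exact congrArg (fun u => Finset.erase (u j) (p j)) h
  · have hcirc := right_ne_zero_of_mul hu
    have hsign := right_ne_zero_of_mul (left_ne_zero_of_mul hu)
    have hshrub := right_ne_zero_of_mul (left_ne_zero_of_mul (left_ne_zero_of_mul hu))
    have hrim := left_ne_zero_of_mul (left_ne_zero_of_mul (left_ne_zero_of_mul hu))
    rw [Finset.prod_ne_zero_iff] at hsign hshrub
    have hmem (j : Fin (m + 1)) : p j ∈ u j := by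
      by_contra h
      exact hsign j (Finset.mem_univ j) (if_neg h)
    have hrim' : rimCoeff (𝒞 b) (i + 1) τ (u 0) ≠ 0 := by rwa [rimCoeff_eq hτ]
    have hupper0 : u 0 ∈ faces (koszul I b) (i + 1) := mem_faces_of_rimCoeff_ne_zero hτ hrim'
    have hcoeff (j : Fin m) (hj : (u j.castSucc).card = i + 1) :
        shrubCoeff (𝒞 (node b p (j + 1))) i ((u j.castSucc).erase (p j.castSucc)) (u j.succ) ≠
          0 := by
      rw [shrubCoeff_eq]
      · exact hshrub j (Finset.mem_univ j)
      · rw [Finset.card_erase_of_mem (hmem _), hj, Nat.add_sub_cancel]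
    have hupper (j : Fin (m + 1)) : u j ∈ faces (koszul I (node b p j)) (i + 1) := by
      induction j using Fin.induction with
      | zero => rwa [Fin.val_zero, node_zero]
      | succ j ih => exact mem_faces_of_shrubCoeff_ne_zero (hcoeff j ih.2)
    have hlower (j : Fin (m + 1)) :
        (u j).erase (p j) ∈ faces (koszul I (node b p (j + 1))) i := by
      refine ⟨?_, by rw [Finset.card_erase_of_mem (hmem _), (hupper j).2, Nat.add_sub_cancel]⟩
      rw [← insert_mem_koszul_add (Finset.notMem_erase _ _), Finset.insert_erase (hmem j),
        ← node_eq_node_succ_add hp]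
      exact (hupper j).1
    have hlast := hlower (Fin.last m)
    rw [Fin.val_last, node_last hp] at hlast
    have hcirc' : circuitCoeff (𝒞 a) i ((u (Fin.last m)).erase (p (Fin.last m))) σ ≠ 0 := by
      rwa [circuitCoeff_eq hlast]
    refine ⟨(u, fun j => (u j).erase (p j)), Finset.mem_filter.2 ⟨Finset.mem_univ _, ?_⟩, ?_, rfl⟩
    · exact ⟨hτ, target_mem_faces_of_circuitCoeff_ne_zero hcirc', hupper, hlower, hrim',
        fun j => ⟨hmem j, rfl⟩,
        fun j => mem_stakes_of_shrubCoeff_ne_zero (hcoeff j (hupper j.castSucc).2),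
        fun j => hcoeff j (hupper j.castSucc).2, hcirc'⟩
    · rwa [hweight (u, fun j => (u j).erase (p j)) (fun j => ⟨hmem j, rfl⟩) hlower]
  · have hφ' := (Finset.mem_filter.1 hφ).2
    exact hweight φ hφ'.facet hφ'.lower_mem

theorem sylvanHom_single {i : ℕ} {a b : Fin n →₀ ℕ} {τ : Finset (Fin n)}
    (hτ : τ ∈ faces (koszul I b) (i + 1)) :
    sylvanHom 𝒞 i a b (Pi.single τ 1) = circuitMap (𝒞 a)
      (∑ p ∈ latticePaths (b.degree - a.degree - 1) a b,
        pathWalk 𝒞 b p (rimMap (𝒞 b) (Pi.single τ 1))) := by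
  classical
  rw [sylvanHom, Fintype.linearCombination_apply_single, one_smul, map_sum]
  ext σ
  have h (y : Chain 𝕜 n) : (∑ σ, y σ • (Pi.single σ 1 : Chain 𝕜 n)) = y := (chain_eq_sum y).symm
  rw [h fun σ => sylvanEntry 𝒞 i a b σ τ, Finset.sum_apply]
  exact Finset.sum_congr rfl fun p hp => sum_simpleWeight 𝒞 hp hτ σ

theorem sylvanHom_eq {i : ℕ} {a b : Fin n →₀ ℕ} {z : Chain 𝕜 n}
    (hz : z ∈ chains 𝕜 (koszul I b) (i + 1)) :
    sylvanHom 𝒞 i a b z = circuitMap (𝒞 a)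
      (∑ p ∈ latticePaths (b.degree - a.degree - 1) a b, pathWalk 𝒞 b p (rimMap (𝒞 b) z)) := by
  have h := eqOn_facesSpan (f := sylvanHom 𝒞 i a b) (g := circuitMap (𝒞 a) ∘ₗ
    (∑ p ∈ latticePaths (b.degree - a.degree - 1) a b, pathWalk 𝒞 b p) ∘ₗ rimMap (𝒞 b))
    (fun τ hτ => by
      rw [sylvanHom_single 𝒞 hτ, LinearMap.comp_apply, LinearMap.comp_apply, LinearMap.sum_apply])
    hz
  rwa [LinearMap.comp_apply, LinearMap.comp_apply, LinearMap.sum_apply] at h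

/-- Each of the `m + 1` descents chooses the vertex of one step, and a choice contributes only if
its steps lead from `b` to `a`. The induction splits off the final step. -/
theorem descent_pow_single (m : ℕ) (a b : Fin n →₀ ℕ) (y : Chain 𝕜 n) :
    descent 𝕜 n (((levelShrub 𝒞 * descent 𝕜 n) ^ m) (Pi.single b y)) a =
      ∑ p ∈ latticePaths m a b, pathWalk 𝒞 b p y := by
  induction m generalizing a with
  | zero =>
    rw [pow_zero, Module.End.one_apply, descent_apply, latticePaths, Finset.sum_filter]
    refine Fintype.sum_equiv (Equiv.funUnique (Fin 1) (Fin n)).symm _ _ fun v => ?_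
    have hsum : a + ∑ _j : Fin (0 + 1), Finsupp.single v 1 = a + Finsupp.single v 1 := by simp
    simp only [pathWalk, walk, Equiv.funUnique_symm_apply, uniqueElim_const, hsum]
    by_cases h : a + Finsupp.single v 1 = b
    · rw [if_pos h, h, Pi.single_eq_same]
    · rw [if_neg h, Pi.single_eq_of_ne h, map_zero]
  | succ m ih =>
    rw [pow_succ', Module.End.mul_apply, Module.End.mul_apply, descent_apply]
    simp only [levelShrub_apply, ih, map_sum]
    simp only [latticePaths, Finset.sum_filter]
    rw [← Finset.sum_product', Finset.univ_product_univ]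
    refine Fintype.sum_equiv (Fin.snocEquiv fun _ => Fin n) _ _ fun q => ?_
    obtain ⟨v, p⟩ := q
    have hsum : a + ∑ j, Finsupp.single ((Fin.snoc p v : Fin (m + 2) → Fin n) j) 1 =
        a + Finsupp.single v 1 + ∑ j, Finsupp.single (p j) 1 := by
      rw [Fin.sum_univ_castSucc]
      simp only [Fin.snoc_castSucc, Fin.snoc_last]
      abel
    have hsnoc : Fin.snocEquiv (fun _ => Fin n) (v, p) = Fin.snoc p v := rfl
    rw [hsnoc, hsum]
    by_cases h : a + Finsupp.single v 1 + ∑ j, Finsupp.single (p j) 1 = b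
    · rw [if_pos h, if_pos h, pathWalk, pathWalk, walk_succ]
      simp only [Fin.snoc_castSucc, Fin.snoc_last, LinearMap.comp_apply, Fin.val_last,
        Fin.val_castSucc]
      rw [node_snoc b p v le_rfl, node_last (mem_latticePaths.2 h)]
      congr 4
      funext j
      rw [node_snoc b p v (by omega)]
    · rw [if_neg h, if_neg h]

/-- Total degrees fix the length of a path from `b` to `a`, so a single power in the geometric
series contributes. -/
theorem descent_resolvent_single {c : Fin n →₀ ℕ} (a : Fin n →₀ ℕ) {b : Fin n →₀ ℕ} (hb : b ≤ c)
    (y : Chain 𝕜 n) :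
    descent 𝕜 n (resolvent 𝒞 c (Pi.single b y)) a =
      ∑ p ∈ latticePaths (b.degree - a.degree - 1) a b, pathWalk 𝒞 b p y := by
  rw [resolvent, LinearMap.sum_apply, map_sum, Finset.sum_apply]
  simp only [descent_pow_single]
  refine Finset.sum_eq_single_of_mem _ (Finset.mem_range.2 ?_) fun m _ hm => ?_
  · have := Finsupp.degree_mono hb
    omega
  · rw [Finset.sum_eq_zero]
    intro p hp
    have := degree_of_mem_latticePaths hp
    omega

theorem sylvanHom_eq_descent {i : ℕ} {a b c : Fin n →₀ ℕ} (hb : b ≤ c) {z : Chain 𝕜 n}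
    (hz : z ∈ chains 𝕜 (koszul I b) (i + 1)) :
    sylvanHom 𝒞 i a b z = circuitMap (𝒞 a)
      (descent 𝕜 n (resolvent 𝒞 c (Pi.single b (rimMap (𝒞 b) z))) a) := by
  rw [sylvanHom_eq 𝒞 hz, descent_resolvent_single 𝒞 a hb]

/-- The first factor of the sylvan homomorphism, the rim map, kills boundaries; the last factor, the
circuit map, takes values in cycles. -/
theorem inducesOnHomology (i : ℕ) (a b : Fin n →₀ ℕ) : InducesOnHomology 𝒞 i a b := by
  refine ⟨fun z hz => ?_, fun z hz => ?_⟩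
  · rw [sylvanHom_eq_descent 𝒞 le_rfl hz.1]
    refine circuitMap_mem_cycles (descent_mem_strandPart (c := b) (resolvent_mem_strandPart
      (single_mem_multispan le_rfl (rimMap_mem hz.1))) a).1
  · rw [sylvanHom_eq_descent 𝒞 le_rfl (boundaries_le_chains _ _ hz), rimMap_eq_zero hz]
    simp

end FenceSum

/-! ### The strands of the Sylvan modules -/

section Generators

variable {𝕜 : Type*} [Field 𝕜] {n : ℕ}

/-- The harmonic representative of a homology class. -/
noncomputable def harmonicRep {K : LowerSet (Finset (Fin n))} (𝒞 : Community 𝕜 K) (k : ℕ) :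
    Homology 𝕜 K k →ₗ[𝕜] Chain 𝕜 n :=
  Submodule.liftQ _ (rimMap 𝒞 ∘ₗ (cycles 𝕜 K k).subtype) fun _ hz => rimMap_eq_zero hz

section HarmonicRep

variable {K : LowerSet (Finset (Fin n))} {𝒞 : Community 𝕜 K} {k : ℕ}

theorem harmonicRep_mk (z : cycles 𝕜 K k) :
    harmonicRep 𝒞 k (Submodule.Quotient.mk z) = rimMap 𝒞 z := rfl

theorem harmonicRep_injective : Function.Injective (harmonicRep 𝒞 k) := by
  rw [← LinearMap.ker_eq_bot, LinearMap.ker_eq_bot']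
  intro h hh
  obtain ⟨z, rfl⟩ := Submodule.Quotient.mk_surjective _ h
  rw [harmonicRep_mk, rimMap_apply, sub_eq_zero] at hh
  rw [Submodule.Quotient.mk_eq_zero]
  change (z : Chain 𝕜 n) ∈ boundaries 𝕜 K k
  rw [hh]
  exact boundary_mem_boundaries (shrubMap_mem_chains z.2.1)

theorem harmonicRep_mem (h : Homology 𝕜 K k) : harmonicRep 𝒞 k h ∈ chains 𝕜 K k := by
  obtain ⟨z, rfl⟩ := Submodule.Quotient.mk_surjective _ h
  exact rimMap_mem z.2.1

theorem boundary_harmonicRep (h : Homology 𝕜 K k) : boundary 𝕜 (harmonicRep 𝒞 k h) = 0 := by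
  obtain ⟨z, rfl⟩ := Submodule.Quotient.mk_surjective _ h
  rw [harmonicRep_mk, rimMap_apply, map_sub, boundary_boundary, sub_zero]
  exact z.2.2

theorem shrubMap_harmonicRep (h : Homology 𝕜 K k) : shrubMap 𝒞 (harmonicRep 𝒞 k h) = 0 := by
  obtain ⟨z, rfl⟩ := Submodule.Quotient.mk_surjective _ h
  rw [harmonicRep_mk, rimMap_apply, map_sub, shrubMap_boundary_shrubMap z.2.1, sub_self]

end HarmonicRep

variable (I : Ideal (MvPolynomial (Fin n) 𝕜))

/-- The generators `x ^ e ⊗ h` of the Sylvan module over the ground field. -/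
noncomputable def sylvanGen (i : ℕ) (b e : Fin n →₀ ℕ) :
    Homology 𝕜 (koszul I b) i →ₗ[𝕜] SylvanModule I i :=
  (DirectSum.lof (MvPolynomial (Fin n) 𝕜) (Fin n →₀ ℕ)
      (fun b => MvPolynomial (Fin n) 𝕜 ⊗[𝕜] Homology 𝕜 (koszul I b) i) b).restrictScalars 𝕜 ∘ₗ
    TensorProduct.mk 𝕜 _ _ (MvPolynomial.monomial e 1)

variable {I}

theorem sylvanGen_apply (i : ℕ) (b e : Fin n →₀ ℕ) (h : Homology 𝕜 (koszul I b) i) :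
    sylvanGen I i b e h = DirectSum.lof (MvPolynomial (Fin n) 𝕜) (Fin n →₀ ℕ)
      (fun b => MvPolynomial (Fin n) 𝕜 ⊗[𝕜] Homology 𝕜 (koszul I b) i) b
      (MvPolynomial.monomial e 1 ⊗ₜ h) := rfl

theorem monomial_smul_sylvanGen (i : ℕ) (b e f : Fin n →₀ ℕ) (h : Homology 𝕜 (koszul I b) i) :
    MvPolynomial.monomial f (1 : 𝕜) • sylvanGen I i b e h = sylvanGen I i b (f + e) h := by
  rw [sylvanGen_apply, sylvanGen_apply, ← map_smul, TensorProduct.smul_tmul', smul_eq_mul,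
    MvPolynomial.monomial_mul, one_mul]

theorem span_sylvanGen (i : ℕ) : Submodule.span 𝕜
    {x : SylvanModule I i | ∃ b e h, x = sylvanGen I i b e h} = ⊤ := by
  rw [eq_top_iff]
  rintro x -
  induction x using DirectSum.induction_on with
  | zero => exact Submodule.zero_mem _
  | add x y hx hy => exact Submodule.add_mem _ hx hy
  | of b t =>
    induction t using TensorProduct.induction_on with
    | zero =>
      rw [map_zero]
      exact Submodule.zero_mem _
    | add x y hx hy =>
      rw [map_add]
      exact Submodule.add_mem _ hx hy
    | tmul f h =>
      induction f using MvPolynomial.induction_on' with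
      | monomial e r =>
        refine Submodule.subset_span ⟨b, e, r • h, ?_⟩
        rw [sylvanGen_apply, ← TensorProduct.smul_tmul, MvPolynomial.smul_monomial, smul_eq_mul,
          mul_one]
        rfl
      | add p q hp hq =>
        rw [TensorProduct.add_tmul, map_add]
        exact Submodule.add_mem _ hp hq

/-- Closure under scalars is not needed, since a scalar multiple of a generator can be absorbed into
its homology class. -/
theorem sylvanModule_induction {i : ℕ} {P : SylvanModule I i → Prop}
    (gen : ∀ b e h, P (sylvanGen I i b e h)) (add : ∀ x y, P x → P y → P (x + y))
    (x : SylvanModule I i) : P x := by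
  have hx : x ∈ Submodule.span 𝕜 {x : SylvanModule I i | ∃ b e h, x = sylvanGen I i b e h} :=
    by rw [span_sylvanGen]; exact Submodule.mem_top
  have h0 : P 0 := by
    have := gen 0 0 0
    rwa [map_zero (sylvanGen I i 0 0)] at this
  induction hx using Submodule.closure_induction with
  | zero => exact h0
  | add x y _ _ hx hy => exact add x y hx hy
  | smul_mem r x hx =>
    obtain ⟨b, e, h, rfl⟩ := hx
    rw [← map_smul]
    exact gen b e _

variable (I) in
/-- The coefficient of `x ^ e` in the summand indexed by `b`. -/
noncomputable def sylvanCoeff (i : ℕ) (b e : Fin n →₀ ℕ) :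
    SylvanModule I i →ₗ[𝕜] Homology 𝕜 (koszul I b) i :=
  Finsupp.lapply e ∘ₗ
    (TensorProduct.equivFinsuppOfBasisLeft
      (MvPolynomial.basisMonomials (Fin n) 𝕜)).toLinearMap ∘ₗ
    DirectSum.component 𝕜 _ _ b

theorem sylvanCoeff_sylvanGen_self (i : ℕ) (b e e' : Fin n →₀ ℕ)
    (h : Homology 𝕜 (koszul I b) i) :
    sylvanCoeff I i b e' (sylvanGen I i b e h) = if e = e' then h else 0 := by
  have hc : DirectSum.component 𝕜 (Fin n →₀ ℕ) _ b (sylvanGen I i b e h) =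
      (MvPolynomial.monomial e (1 : 𝕜)) ⊗ₜ[𝕜] h := DirectSum.component.lof_self 𝕜 b _
  have he : MvPolynomial.monomial e (1 : 𝕜) = MvPolynomial.basisMonomials (Fin n) 𝕜 e := by simp
  rw [sylvanCoeff, LinearMap.comp_apply, LinearMap.comp_apply, hc, LinearEquiv.coe_coe,
    TensorProduct.equivFinsuppOfBasisLeft_apply_tmul, he, Module.Basis.repr_self,
    Finsupp.lapply_apply, Finsupp.mapRange_apply, Finsupp.single_apply]
  split_ifs <;> simp

theorem sylvanCoeff_sylvanGen_ne (i : ℕ) {b b' : Fin n →₀ ℕ} (hb : b ≠ b') (e e' : Fin n →₀ ℕ)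
    (h : Homology 𝕜 (koszul I b) i) : sylvanCoeff I i b' e' (sylvanGen I i b e h) = 0 := by
  have hc : DirectSum.component 𝕜 (Fin n →₀ ℕ) _ b' (sylvanGen I i b e h) = 0 :=
    DFinsupp.single_eq_of_ne hb.symm
  rw [sylvanCoeff, LinearMap.comp_apply, LinearMap.comp_apply, hc, map_zero, map_zero]

theorem eq_zero_of_sylvanCoeff {i : ℕ} {x : SylvanModule I i}
    (h : ∀ b e, sylvanCoeff I i b e x = 0) : x = 0 := by
  refine DFinsupp.ext fun b => ?_
  refine (TensorProduct.equivFinsuppOfBasisLeft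
    (MvPolynomial.basisMonomials (Fin n) 𝕜)).injective (Finsupp.ext fun e => ?_)
  refine (h b e).trans ?_
  rw [DFinsupp.zero_apply, map_zero, Finsupp.zero_apply]

end Generators

/-! ### Graded pieces of the sylvan modules as harmonic families. -/

section StrandMap

variable {𝕜 : Type*} [Field 𝕜] {n : ℕ} {I : Ideal (MvPolynomial (Fin n) 𝕜)}
  (𝒞 : ∀ b, Community 𝕜 (koszul I b))

/-- The component of degree `c` of an element of the Sylvan module, as a family of harmonic
chains. -/
noncomputable def strandMap (i : ℕ) (c : Fin n →₀ ℕ) : SylvanModule I i →ₗ[𝕜] Multichain 𝕜 n :=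
  open Classical in
  LinearMap.pi fun b => if b ≤ c then harmonicRep (𝒞 b) i ∘ₗ sylvanCoeff I i b (c - b) else 0

variable {𝒞} {i : ℕ}

theorem strandMap_apply (c b : Fin n →₀ ℕ) (x : SylvanModule I i) [Decidable (b ≤ c)] :
    strandMap 𝒞 i c x b = if b ≤ c then harmonicRep (𝒞 b) i (sylvanCoeff I i b (c - b) x)
      else 0 := by
  rw [strandMap, LinearMap.pi_apply]
  split_ifs <;> rfl

theorem strandMap_sylvanGen (c b e : Fin n →₀ ℕ) (h : Homology 𝕜 (koszul I b) i) :
    strandMap 𝒞 i c (sylvanGen I i b e h) =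
      if e + b = c then Pi.single b (harmonicRep (𝒞 b) i h) else 0 := by
  classical
  funext b'
  rw [strandMap_apply]
  by_cases hb : b = b'
  · subst hb
    rw [sylvanCoeff_sylvanGen_self]
    by_cases hc : e + b = c
    · subst hc
      simp
    · rw [if_neg hc]
      split_ifs with h1 h2
      · exact absurd (by rw [h2, tsub_add_cancel_of_le h1]) hc
      · rw [map_zero]; rfl
      · rfl
  · rw [sylvanCoeff_sylvanGen_ne i hb, map_zero, ite_self]
    split_ifs
    · rw [Pi.single_eq_of_ne (Ne.symm hb)]
    · rfl

theorem strandMap_mem (c : Fin n →₀ ℕ) (x : SylvanModule I i) :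
    strandMap 𝒞 i c x ∈ strandPart I c i := by
  classical
  intro b
  rw [strandMap_apply]
  refine ⟨?_, fun h => if_neg h⟩
  split_ifs
  · exact harmonicRep_mem _
  · exact Submodule.zero_mem _

theorem isHarmonic_strandMap (c : Fin n →₀ ℕ) (x : SylvanModule I i) :
    IsHarmonic 𝒞 (strandMap 𝒞 i c x) := by
  classical
  refine ⟨funext fun b => ?_, funext fun b => ?_⟩
  · rw [levelBoundary_apply, strandMap_apply]
    split_ifs
    · exact boundary_harmonicRep _
    · exact map_zero _
  · rw [levelShrub_apply, strandMap_apply]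
    split_ifs
    · exact shrubMap_harmonicRep _
    · exact map_zero _

theorem eq_zero_of_strandMap {x : SylvanModule I i} (h : ∀ c, strandMap 𝒞 i c x = 0) : x = 0 := by
  classical
  refine eq_zero_of_sylvanCoeff fun b e => harmonicRep_injective (𝒞 := 𝒞 b) ?_
  have := congrFun (h (e + b)) b
  rw [strandMap_apply, if_pos (self_le_add_left _ _), add_tsub_cancel_right] at this
  rw [this, map_zero]
  rfl

theorem eq_of_strandMap {x y : SylvanModule I i}
    (h : ∀ c, strandMap 𝒞 i c x = strandMap 𝒞 i c y) : x = y :=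
  sub_eq_zero.1 (eq_zero_of_strandMap (𝒞 := 𝒞) fun c => by rw [map_sub, h, sub_self])

theorem exists_strandMap_support (x : SylvanModule I i) :
    ∃ s : Finset (Fin n →₀ ℕ), ∀ c ∉ s, strandMap 𝒞 i c x = 0 := by
  classical
  induction x using sylvanModule_induction with
  | gen b e h =>
    refine ⟨{e + b}, fun c hc => ?_⟩
    rw [strandMap_sylvanGen, if_neg fun h => hc (by simp [h])]
  | add x y hx hy =>
    obtain ⟨s, hs⟩ := hx
    obtain ⟨t, ht⟩ := hy
    refine ⟨s ∪ t, fun c hc => ?_⟩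
    rw [Finset.mem_union, not_or] at hc
    rw [map_add, hs c hc.1, ht c hc.2, add_zero]

/-- A harmonic chain is a cycle equal to its own hedge rim, so its homology class returns it. -/
theorem exists_strandMap_eq {c : Fin n →₀ ℕ} {w : Multichain 𝕜 n} (hw : w ∈ strandPart I c i)
    (hh : IsHarmonic 𝒞 w) :
    ∃ x : SylvanModule I i, strandMap 𝒞 i c x = w ∧ ∀ c' ≠ c, strandMap 𝒞 i c' x = 0 := by
  have hz (b : Fin n →₀ ℕ) : w b ∈ cycles 𝕜 (koszul I b) i :=
    ⟨(hw b).1, congrFun hh.1 b⟩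
  have hrep (b : Fin n →₀ ℕ) :
      harmonicRep (𝒞 b) i (Submodule.Quotient.mk ⟨w b, hz b⟩) = w b := by
    have h0 : shrubMap (𝒞 b) (w b) = 0 := congrFun hh.2 b
    rw [harmonicRep_mk, rimMap_apply]
    simp [h0]
  refine ⟨∑ b ∈ Finset.Iic c, sylvanGen I i b (c - b) (Submodule.Quotient.mk ⟨w b, hz b⟩),
    ?_, fun c' hc' => ?_⟩
  · rw [map_sum]
    funext b
    rw [Finset.sum_apply]
    by_cases hb : b ≤ c
    · rw [Finset.sum_eq_single_of_mem b (Finset.mem_Iic.2 hb)]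
      · rw [strandMap_sylvanGen, if_pos (tsub_add_cancel_of_le hb), Pi.single_eq_same, hrep]
      · intro b' _ hb'
        rw [strandMap_sylvanGen]
        split_ifs
        · rw [Pi.single_eq_of_ne (Ne.symm hb')]
        · rfl
    · rw [(hw b).2 hb]
      refine Finset.sum_eq_zero fun b' hb' => ?_
      rw [strandMap_sylvanGen, if_pos (tsub_add_cancel_of_le (Finset.mem_Iic.1 hb')),
        Pi.single_eq_of_ne]
      rintro rfl
      exact hb (Finset.mem_Iic.1 hb')
  · rw [map_sum]
    refine Finset.sum_eq_zero fun b hb => ?_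
    rw [strandMap_sylvanGen, tsub_add_cancel_of_le (Finset.mem_Iic.1 hb), if_neg (Ne.symm hc')]

/-! ### The Sylvan differential on strands -/

variable (h : ∀ a b : Fin n →₀ ℕ, a < b → ∀ i, InducesOnHomology 𝒞 i a b)

theorem sylvanDifferential_sylvanGen (b e : Fin n →₀ ℕ) (z : Homology 𝕜 (koszul I b) (i + 1)) :
    sylvanDifferential 𝒞 h i (sylvanGen I (i + 1) b e z) =
      ∑ a ∈ (Finset.Iio b).attach, sylvanGen I i a.1 (b - a.1 + e)
        (sylvanHomology 𝒞 i a.1 b (h a.1 b (Finset.mem_Iio.1 a.2) i) z) := by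
  rw [sylvanGen_apply, sylvanDifferential, DirectSum.toModule_lof, LinearMap.sum_apply]
  refine Finset.sum_congr rfl fun a _ => ?_
  rw [← monomial_smul_sylvanGen, sylvanGen_apply, LinearMap.comp_apply, LinearMap.smul_apply,
    LinearMap.baseChange_tmul, map_smul]

/-- Rim map after circuit map is (1 - ∂h)(1 - h∂), which equals the harmonic projection because h² =
0. -/
theorem harmonicRep_sylvanHomology {a b c : Fin n →₀ ℕ} (hb : b ≤ c)
    (hab : InducesOnHomology 𝒞 i a b) (z : Homology 𝕜 (koszul I b) (i + 1)) :
    harmonicRep (𝒞 a) i (sylvanHomology 𝒞 i a b hab z) =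
      transfer 𝒞 c (Pi.single b (harmonicRep (𝒞 b) (i + 1) z)) a := by
  obtain ⟨z, rfl⟩ := Submodule.Quotient.mk_surjective _ z
  have hs : (Pi.single b (rimMap (𝒞 b) z) : Multichain 𝕜 n) ∈ strandPart I c (i + 1) :=
    single_mem_multispan hb (rimMap_mem z.2.1)
  have hd := (descent_mem_strandPart (resolvent_mem_strandPart (𝒞 := 𝒞) hs) a).1
  have h1 : harmonicRep (𝒞 a) i (sylvanHomology 𝒞 i a b hab (Submodule.Quotient.mk z)) =
      rimMap (𝒞 a) (sylvanHom 𝒞 i a b z) := rfl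
  rw [h1, harmonicRep_mk, sylvanHom_eq_descent 𝒞 hb z.2.1, transfer_apply, harmonicProj_apply]
  generalize descent 𝕜 n (resolvent 𝒞 c (Pi.single b (rimMap (𝒞 b) z))) = y at hd
  have h2 : shrubMap (𝒞 a) (shrubMap (𝒞 a) (boundary 𝕜 (y a))) = 0 := by
    cases i with
    | zero => rw [boundary_eq_zero_of_mem_chains_zero hd, map_zero, map_zero]
    | succ i => exact shrubMap_shrubMap (boundary_mem_chains hd)
  simp only [Pi.sub_apply, levelBoundary_apply, levelShrub_apply, rimMap_apply, circuitMap_apply,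
    map_sub, h2, map_zero, sub_zero]

theorem transfer_single_eq_zero {a b c : Fin n →₀ ℕ} (hb : b ≤ c) (hab : ¬ a < b)
    (y : Chain 𝕜 n) : transfer 𝒞 c (Pi.single b y) a = 0 := by
  have h0 : descent 𝕜 n (resolvent 𝒞 c (Pi.single b y)) a = 0 := by
    rw [descent_resolvent_single 𝒞 a hb]
    refine Finset.sum_eq_zero fun p hp => absurd (lt_of_le_of_ne (le_of_mem_latticePaths hp) ?_) hab
    rintro rfl
    have := degree_of_mem_latticePaths hp
    omega
  rw [transfer_apply, harmonicProj_apply]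
  simp [levelBoundary_apply, levelShrub_apply, h0]

theorem strandMap_sylvanDifferential (c : Fin n →₀ ℕ) (x : SylvanModule I (i + 1)) :
    strandMap 𝒞 i c (sylvanDifferential 𝒞 h i x) = transfer 𝒞 c (strandMap 𝒞 (i + 1) c x) := by
  induction x using sylvanModule_induction with
  | add x y hx hy => rw [map_add, map_add, map_add, map_add, hx, hy]
  | gen b e z =>
    rw [sylvanDifferential_sylvanGen, map_sum, strandMap_sylvanGen]
    have hc (a : Finset.Iio b) : b - a.1 + e + a.1 = e + b := by
      rw [add_right_comm, tsub_add_cancel_of_le (Finset.mem_Iio.1 a.2).le, add_comm]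
    simp only [strandMap_sylvanGen, hc]
    by_cases hcb : e + b = c
    swap
    · simp [hcb]
    have hb : b ≤ c := hcb ▸ self_le_add_left _ _
    simp only [if_pos hcb]
    funext a
    rw [Finset.sum_apply]
    by_cases ha : a < b
    · rw [Finset.sum_eq_single_of_mem ⟨a, Finset.mem_Iio.2 ha⟩ (Finset.mem_attach _ _),
        Pi.single_eq_same, harmonicRep_sylvanHomology hb]
      intro a' _ ha'
      exact Pi.single_eq_of_ne (fun h' => ha' (Subtype.ext h'.symm)) _
    · rw [transfer_single_eq_zero hb ha]
      refine Finset.sum_eq_zero fun a' _ => Pi.single_eq_of_ne ?_ _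
      rintro rfl
      exact ha (Finset.mem_Iio.1 a'.2)

/-- An element has only finitely many nonzero graded components, so preimages found degree by degree
can be summed. -/
theorem mem_range_sylvanDifferential {y : SylvanModule I i}
    (hy : ∀ c, ∃ w ∈ strandPart I c (i + 1), IsHarmonic 𝒞 w ∧
      transfer 𝒞 c w = strandMap 𝒞 i c y) : y ∈ Set.range (sylvanDifferential 𝒞 h i) := by
  obtain ⟨s, hs⟩ := exists_strandMap_support (𝒞 := 𝒞) y
  choose w hw hwh hwy using hy
  choose u hu hu' using fun c => exists_strandMap_eq (hw c) (hwh c)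
  refine ⟨∑ c ∈ s, u c, eq_of_strandMap (𝒞 := 𝒞) fun c => ?_⟩
  rw [strandMap_sylvanDifferential, map_sum]
  by_cases hc : c ∈ s
  · rw [Finset.sum_eq_single_of_mem c hc fun c' _ hc' => hu' c' c hc'.symm, hu, hwy]
  · rw [Finset.sum_eq_zero fun c' hc' => hu' c' c fun h' => hc (h' ▸ hc'), hs c hc, map_zero]

theorem sylvanDifferential_exact (i : ℕ) :
    Function.Exact (sylvanDifferential 𝒞 h (i + 1)) (sylvanDifferential 𝒞 h i) := by
  intro y
  constructor
  · intro hy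
    refine mem_range_sylvanDifferential h fun c => ?_
    refine transfer_exact (strandMap_mem c y) (isHarmonic_strandMap c y) ?_ fun h => by omega
    rw [← strandMap_sylvanDifferential h, hy, map_zero]
  · rintro ⟨x, rfl⟩
    refine eq_zero_of_strandMap (𝒞 := 𝒞) fun c => ?_
    rw [strandMap_sylvanDifferential, strandMap_sylvanDifferential,
      transfer_transfer (strandPart_le_strand _ (strandMap_mem c x)) (isHarmonic_strandMap c x)]

theorem sylvanDifferential_homogeneous (c : Fin n →₀ ℕ) {x : SylvanModule I (i + 1)}
    (hx : x ∈ sylvanPiece I (i + 1) c) : sylvanDifferential 𝒞 h i x ∈ sylvanPiece I i c := by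
  induction hx using Submodule.span_induction with
  | zero =>
    rw [map_zero]
    exact Submodule.zero_mem _
  | add x y _ _ hx hy =>
    rw [map_add]
    exact Submodule.add_mem _ hx hy
  | smul r x _ hx =>
    rw [LinearMap.map_smul_of_tower]
    exact Submodule.smul_mem _ _ hx
  | mem x hx =>
    obtain ⟨e, b, z, hc, rfl⟩ := hx
    rw [← sylvanGen_apply, sylvanDifferential_sylvanGen]
    refine Submodule.sum_mem _ fun a _ => Submodule.subset_span ⟨_, a.1, _, ?_, rfl⟩
    rw [add_right_comm, tsub_add_cancel_of_le (Finset.mem_Iio.1 a.2).le, add_comm, hc]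

theorem monomial_mem_maximal {e : Fin n →₀ ℕ} (he : e ≠ 0) :
    MvPolynomial.monomial e (1 : 𝕜) ∈
      Ideal.span (Set.range (MvPolynomial.X : Fin n → MvPolynomial (Fin n) 𝕜)) := by
  obtain ⟨v, hv⟩ := Finsupp.ne_iff.1 he
  have hle : Finsupp.single v 1 ≤ e := by
    rw [Finsupp.single_le_iff]
    exact Nat.one_le_iff_ne_zero.2 hv
  have : MvPolynomial.monomial e (1 : 𝕜) =
      MvPolynomial.monomial (e - Finsupp.single v 1) 1 * MvPolynomial.X v := by
    rw [MvPolynomial.X, MvPolynomial.monomial_mul, tsub_add_cancel_of_le hle, one_mul]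
  rw [this]
  exact Ideal.mul_mem_left _ _ (Ideal.subset_span ⟨v, rfl⟩)

theorem range_sylvanDifferential_le (i : ℕ) : LinearMap.range (sylvanDifferential 𝒞 h i) ≤
    Ideal.span (Set.range (MvPolynomial.X : Fin n → MvPolynomial (Fin n) 𝕜)) •
      (⊤ : Submodule (MvPolynomial (Fin n) 𝕜) (SylvanModule I i)) := by
  rintro _ ⟨x, rfl⟩
  induction x using sylvanModule_induction with
  | add x y hx hy =>
    rw [map_add]
    exact Submodule.add_mem _ hx hy
  | gen b e z =>
    rw [sylvanDifferential_sylvanGen]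
    refine Submodule.sum_mem _ fun a _ => ?_
    rw [← monomial_smul_sylvanGen]
    refine Submodule.smul_mem_smul (monomial_mem_maximal ?_) Submodule.mem_top
    intro h0
    exact (Finset.mem_Iio.1 a.2).not_ge (tsub_eq_zero_iff_le.1 h0)

end StrandMap

/-! ### The augmentation -/

section Augmentation

variable {𝕜 : Type*} [Field 𝕜] {n : ℕ} {I : Ideal (MvPolynomial (Fin n) 𝕜)}
  (𝒞 : ∀ b, Community 𝕜 (koszul I b))

/-- The augmentation of the Sylvan resolution, with values in the polynomial ring. -/
noncomputable def augmentation :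
    SylvanModule I 0 →ₗ[MvPolynomial (Fin n) 𝕜] MvPolynomial (Fin n) 𝕜 :=
  DirectSum.toModule (MvPolynomial (Fin n) 𝕜) (Fin n →₀ ℕ) (MvPolynomial (Fin n) 𝕜) fun b =>
    MvPolynomial.monomial b (1 : 𝕜) •
      ((TensorProduct.AlgebraTensorModule.rid 𝕜 (MvPolynomial (Fin n) 𝕜)
        (MvPolynomial (Fin n) 𝕜)).toLinearMap ∘ₗ
      (LinearMap.proj ∅ ∘ₗ harmonicRep (𝒞 b) 0).baseChange (MvPolynomial (Fin n) 𝕜))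

variable {𝒞}

theorem augmentation_sylvanGen (b e : Fin n →₀ ℕ) (h : Homology 𝕜 (koszul I b) 0) :
    augmentation 𝒞 (sylvanGen I 0 b e h) =
      MvPolynomial.monomial (e + b) (harmonicRep (𝒞 b) 0 h ∅) := by
  rw [augmentation, sylvanGen_apply, DirectSum.toModule_lof, LinearMap.smul_apply,
    LinearMap.comp_apply, LinearMap.baseChange_tmul, LinearEquiv.coe_coe,
    TensorProduct.AlgebraTensorModule.rid_tmul, LinearMap.comp_apply, LinearMap.proj_apply,
    MvPolynomial.smul_monomial, smul_eq_mul, smul_eq_mul, mul_one, MvPolynomial.monomial_mul,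
    one_mul, add_comm]

/-- This reduces exactness at stage 0 to the strands, coefficient by coefficient. -/
theorem coeff_augmentation (c : Fin n →₀ ℕ) (x : SylvanModule I 0) :
    MvPolynomial.coeff c (augmentation 𝒞 x) = strandAugmentation c (strandMap 𝒞 0 c x) := by
  classical
  induction x using sylvanModule_induction with
  | add x y hx hy => rw [map_add, map_add, map_add, MvPolynomial.coeff_add, hx, hy]
  | gen b e h =>
    rw [augmentation_sylvanGen, MvPolynomial.coeff_monomial, strandMap_sylvanGen]
    split_ifs with hc
    · rw [strandAugmentation_apply, Finset.sum_eq_single_of_mem b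
        (Finset.mem_Iic.2 (hc ▸ self_le_add_left _ _)), Pi.single_eq_same]
      intro b' _ hb'
      rw [Pi.single_eq_of_ne hb', Pi.zero_apply]
    · rw [map_zero]

theorem empty_mem_koszul {b : Fin n →₀ ℕ} :
    ∅ ∈ koszul I b ↔ MvPolynomial.monomial b (1 : 𝕜) ∈ I := by
  simp [mem_koszul, charVec]

theorem augmentation_mem (x : SylvanModule I 0) : augmentation 𝒞 x ∈ I := by
  induction x using sylvanModule_induction with
  | add x y hx hy =>
    rw [map_add]
    exact I.add_mem hx hy
  | gen b e h =>
    rw [augmentation_sylvanGen]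
    by_cases hb : MvPolynomial.monomial b (1 : 𝕜) ∈ I
    · rw [← mul_one (harmonicRep (𝒞 b) 0 h ∅), ← MvPolynomial.monomial_mul]
      exact I.mul_mem_left _ hb
    · rw [harmonicRep_mem h ∅ fun h' => hb (empty_mem_koszul.1 h'.1), map_zero]
      exact I.zero_mem

theorem monomial_mem_range_augmentation (b : Fin n →₀ ℕ)
    (hb : MvPolynomial.monomial b (1 : 𝕜) ∈ I) :
    MvPolynomial.monomial b (1 : 𝕜) ∈ LinearMap.range (augmentation 𝒞) := by
  induction b using WellFoundedLT.induction with
  | ind b ih =>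
    by_cases h : ∃ v, Finsupp.single v 1 ≤ b ∧
        MvPolynomial.monomial (b - Finsupp.single v 1) (1 : 𝕜) ∈ I
    · obtain ⟨v, hv, hI⟩ := h
      have hlt : b - Finsupp.single v 1 < b := by
        refine lt_of_le_of_ne tsub_le_self fun h => ?_
        have h1 := Finsupp.single_le_iff.1 hv
        have h2 := DFunLike.congr_fun h v
        simp at h2
        omega
      have := Submodule.smul_mem _ (MvPolynomial.X v) (ih _ hlt hI)
      rwa [MvPolynomial.X, smul_eq_mul, MvPolynomial.monomial_mul, one_mul,
        add_tsub_cancel_of_le hv] at this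
    -- Now the monomial is a minimal generator: the Koszul complex has no vertices, so ∅ is its own
    -- harmonic representative.
    · have hz : (Pi.single ∅ 1 : Chain 𝕜 n) ∈ chains 𝕜 (koszul I b) 0 :=
        single_mem_facesSpan ⟨empty_mem_koszul.2 hb, rfl⟩
      have hs : shrubMap (𝒞 b) (Pi.single ∅ 1) = 0 := by
        funext τ
        refine shrubMap_mem_chains hz τ fun hτ => h ?_
        obtain ⟨v, rfl⟩ := Finset.card_eq_one.1 hτ.2
        have h1 := hτ.1
        rw [mem_koszul, charVec, Finset.sum_singleton] at h1
        exact ⟨v, h1⟩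
      refine ⟨sylvanGen I 0 b 0 (Submodule.Quotient.mk ⟨_, hz,
        boundary_eq_zero_of_mem_chains_zero hz⟩), ?_⟩
      rw [augmentation_sylvanGen, harmonicRep_mk, rimMap_apply, hs]
      simp

theorem exists_augmentation (hI : IsMonomialIdeal I)
    (h : ∀ a b : Fin n →₀ ℕ, a < b → ∀ i, InducesOnHomology 𝒞 i a b) :
    ∃ ε : SylvanModule I 0 →ₗ[MvPolynomial (Fin n) 𝕜] I,
      Function.Surjective ε ∧ Function.Exact (sylvanDifferential 𝒞 h 0) ε ∧
        ∀ c, ∀ x ∈ sylvanPiece I 0 c,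
          ∃ t : 𝕜, (ε x : MvPolynomial (Fin n) 𝕜) = MvPolynomial.monomial c t := by
  refine ⟨(augmentation 𝒞).codRestrict I augmentation_mem, ?_, ?_, ?_⟩
  · rintro ⟨f, hf⟩
    have hle : I ≤ LinearMap.range (augmentation 𝒞) := by
      obtain ⟨A, hA⟩ := hI
      conv_lhs => rw [hA]
      refine Ideal.span_le.2 ?_
      rintro _ ⟨e, he, rfl⟩
      exact monomial_mem_range_augmentation e (hA ▸ Ideal.subset_span ⟨e, he, rfl⟩)
    obtain ⟨x, hx⟩ := hle hf
    exact ⟨x, Subtype.ext hx⟩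
  · intro y
    constructor
    · intro hy
      have hy' : augmentation 𝒞 y = 0 := congrArg Subtype.val hy
      refine mem_range_sylvanDifferential h fun c => ?_
      have hm := strandMap_mem (𝒞 := 𝒞) c y
      refine transfer_exact hm (isHarmonic_strandMap c y) ?_ fun _ => ?_
      · rw [transfer_apply, resolvent_of_mem_strandPart_zero hm, descent_eq_zero hm, map_zero]
      · rw [← coeff_augmentation, hy', MvPolynomial.coeff_zero]
    · rintro ⟨x, rfl⟩
      refine Subtype.ext (MvPolynomial.ext _ _ fun c => ?_)
      refine (coeff_augmentation c _).trans ?_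
      rw [strandMap_sylvanDifferential, strandAugmentation_transfer (strandMap_mem c x)
        (isHarmonic_strandMap c x)]
      rfl
  · intro c x hx
    simp only [LinearMap.codRestrict_apply]
    induction hx using Submodule.span_induction with
    | zero => exact ⟨0, by rw [map_zero, map_zero]⟩
    | add x y _ _ hx hy =>
      obtain ⟨t, ht⟩ := hx
      obtain ⟨u, hu⟩ := hy
      exact ⟨t + u, by rw [map_add, map_add, ht, hu]⟩
    | smul r x _ hx =>
      obtain ⟨t, ht⟩ := hx
      exact ⟨r • t, by rw [LinearMap.map_smul_of_tower, ht, MvPolynomial.smul_monomial]⟩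
    | mem x hx =>
      obtain ⟨e, b, z, rfl, rfl⟩ := hx
      exact ⟨_, augmentation_sylvanGen b e z⟩

end Augmentation

/-! ### Finiteness -/

section Finiteness

variable {𝕜 : Type*} [Field 𝕜] {n : ℕ} {I : Ideal (MvPolynomial (Fin n) 𝕜)}

theorem charVec_apply (τ : Finset (Fin n)) (v : Fin n) :
    charVec τ v = if v ∈ τ then 1 else 0 := by
  simp [charVec, Finsupp.finsetSum_apply, Finsupp.single_apply]

/-- The homology of a cone vanishes. -/
theorem subsingleton_homology_of_cone {K : LowerSet (Finset (Fin n))} {v : Fin n}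
    (hv : ∀ τ ∈ K, insert v τ ∈ K) (k : ℕ) : Subsingleton (Homology 𝕜 K k) := by
  rw [Submodule.Quotient.subsingleton_iff, eq_top_iff]
  rintro ⟨z, hz, hbz⟩ -
  refine ⟨addVertex v z, fun τ hτ => ?_, ?_⟩
  · rw [addVertex_apply]
    split_ifs with h
    · rw [hz, mul_zero]
      refine fun h' => hτ ⟨?_, ?_⟩
      · have := hv _ h'.1
        rwa [Finset.insert_erase h] at this
      · rw [← h'.2, Finset.card_erase_add_one h]
    · rfl
  -- Adding the apex is a contracting homotopy: other vertices cancel, and `v` itself yields two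
  -- complementary projections.
  · have h1 : boundary 𝕜 (addVertex v z) + addVertex v (boundary 𝕜 z) = z := by
      rw [boundary_apply_eq_sum, boundary_apply_eq_sum, map_sum, ← Finset.sum_add_distrib,
        Finset.sum_eq_single v (fun w _ hw => removeVertex_addVertex hw z) (by simp)]
      funext σ
      rw [Pi.add_apply, removeVertex_addVertex_self, addVertex_removeVertex_self]
      split_ifs <;> simp
    rw [LinearMap.mem_ker.1 hbz, map_zero, add_zero] at h1
    exact h1

theorem exists_finset_homology_subsingleton (hI : IsMonomialIdeal I) :
    ∃ s : Finset (Fin n →₀ ℕ), ∀ b ∉ s, ∀ k, Subsingleton (Homology 𝕜 (koszul I b) k) := by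
  classical
  obtain ⟨A, hA⟩ := hI
  obtain ⟨t, ht, hspan⟩ := (Submodule.fg_span_iff_fg_span_finset_subset _).1
    (IsNoetherian.noetherian (Ideal.span
      ((fun e => MvPolynomial.monomial e (1 : 𝕜)) '' A)))
  obtain ⟨s, -, rfl⟩ := Finset.subset_set_image_iff.1 ht
  have hmem (u : Fin n →₀ ℕ) : MvPolynomial.monomial u (1 : 𝕜) ∈ I ↔ ∃ g ∈ s, g ≤ u := by
    have : I = Ideal.span ((fun e => MvPolynomial.monomial e (1 : 𝕜)) '' (s : Set (Fin n →₀ ℕ))) := by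
      rw [hA, ← Finset.coe_image]
      exact hspan
    rw [this, MvPolynomial.mem_ideal_span_monomial_image,
      MvPolynomial.support_monomial, if_neg one_ne_zero]
    simp
  -- If `b` exceeds the join of the finitely many generating exponents at `v`, lowering `b v` by one
  -- keeps every divisibility, so the Koszul complex is a cone with apex `v`.
  refine ⟨Finset.Iic (s.sup id), fun b hb k => ?_⟩
  obtain ⟨v, hv⟩ : ∃ v, s.sup id v < b v := by
    by_contra! h
    exact hb (Finset.mem_Iic.2 h)
  refine subsingleton_homology_of_cone (v := v) (fun τ hτ => ?_) k
  by_cases hvτ : v ∈ τ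
  · rwa [Finset.insert_eq_of_mem hvτ]
  rw [mem_koszul, hmem] at hτ ⊢
  obtain ⟨h1, g, hg, h2⟩ := hτ
  have hgv : g v ≤ s.sup id v := Finset.le_sup (f := id) hg v
  refine ⟨fun w => ?_, g, hg, fun w => ?_⟩
  · have := h1 w
    rw [charVec_apply] at this ⊢
    by_cases hw : w = v
    · subst hw
      simp
      omega
    · simpa [hw] using this
  · have := h2 w
    rw [Finsupp.tsub_apply, charVec_apply] at this ⊢
    by_cases hw : w = v
    · subst hw
      simp
      omega
    · simpa [hw] using this

theorem dfinsupp_basis_apply {ι R : Type*} {M : ι → Type*} {η : ι → Type*} [DecidableEq ι]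
    [Semiring R] [∀ i, AddCommMonoid (M i)] [∀ i, Module R (M i)]
    (b : ∀ i, Module.Basis (η i) R (M i)) (q : Σ i, η i) :
    DFinsupp.basis b q = DFinsupp.single q.1 (b q.1 q.2) := by
  classical
  refine (DFinsupp.basis b).repr.injective ?_
  rw [Module.Basis.repr_self, DFinsupp.basis]
  change _ = (sigmaFinsuppLequivDFinsupp R).symm
    (DFinsupp.mapRange.linearEquiv (fun i => (b i).repr) (DFinsupp.single q.1 (b q.1 q.2)))
  rw [LinearEquiv.eq_symm_apply, DFinsupp.mapRange.linearEquiv_apply, DFinsupp.mapRange_single,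
    Module.Basis.repr_self]
  exact sigmaFinsuppEquivDFinsupp_single q 1

theorem exists_graded_basis (hI : IsMonomialIdeal I) (i : ℕ) :
    ∃ (r : ℕ) (B : Module.Basis (Fin r) (MvPolynomial (Fin n) 𝕜) (SylvanModule I i))
      (deg : Fin r → (Fin n →₀ ℕ)), ∀ c, sylvanPiece I i c = Submodule.span 𝕜
        {x | ∃ (e : Fin n →₀ ℕ) (j : Fin r), e + deg j = c ∧
          x = MvPolynomial.monomial e (1 : 𝕜) • B j} := by
  obtain ⟨s, hs⟩ := exists_finset_homology_subsingleton hI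
  let β (b : Fin n →₀ ℕ) := Module.finBasis 𝕜 (Homology 𝕜 (koszul I b) i)
  let B₀ : Module.Basis (Σ b : Fin n →₀ ℕ, Fin (Module.finrank 𝕜 (Homology 𝕜 (koszul I b) i)))
      (MvPolynomial (Fin n) 𝕜) (SylvanModule I i) :=
    DFinsupp.basis fun b => Algebra.TensorProduct.basis (MvPolynomial (Fin n) 𝕜) (β b)
  have hB₀ (b : Fin n →₀ ℕ) (j) (e : Fin n →₀ ℕ) :
      MvPolynomial.monomial e (1 : 𝕜) • B₀ ⟨b, j⟩ = sylvanGen I i b e (β b j) := by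
    have : B₀ ⟨b, j⟩ = sylvanGen I i b 0 (β b j) := by
      rw [dfinsupp_basis_apply, Algebra.TensorProduct.basis_apply]
      rfl
    rw [this, monomial_smul_sylvanGen, add_zero]
  -- Degrees outside `s` carry no basis elements, so the index set of the basis is finite.
  have hmem (q : Σ b : Fin n →₀ ℕ, Fin (Module.finrank 𝕜 (Homology 𝕜 (koszul I b) i))) :
      q.1 ∈ s := by
    by_contra h
    have := hs q.1 h i
    have h0 : Module.finrank 𝕜 (Homology 𝕜 (koszul I q.1) i) = 0 := Module.finrank_zero_of_subsingleton
    exact (Fin.cast h0 q.2).elim0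
  have : Finite (Σ b : Fin n →₀ ℕ, Fin (Module.finrank 𝕜 (Homology 𝕜 (koszul I b) i))) :=
    Finite.of_injective (β := Σ b : s, Fin (Module.finrank 𝕜 (Homology 𝕜 (koszul I b) i)))
      (fun q => ⟨⟨q.1, hmem q⟩, q.2⟩) (by
        rintro ⟨b, j⟩ ⟨b', j'⟩ h
        simpa using h)
  let e₀ := Finite.equivFin
    (Σ b : Fin n →₀ ℕ, Fin (Module.finrank 𝕜 (Homology 𝕜 (koszul I b) i)))
  refine ⟨_, B₀.reindex e₀, fun j => (e₀.symm j).1, fun c => le_antisymm ?_ ?_⟩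
  · refine Submodule.span_le.2 ?_
    rintro _ ⟨e, b, h, hc, rfl⟩
    rw [← sylvanGen_apply]
    have hh : h ∈ Submodule.span 𝕜 (Set.range (β b)) := by
      rw [(β b).span_eq]
      exact Submodule.mem_top
    have := Submodule.mem_map_of_mem (f := sylvanGen I i b e) hh
    rw [Submodule.map_span] at this
    refine Submodule.span_mono ?_ this
    rintro _ ⟨_, ⟨j, rfl⟩, rfl⟩
    refine ⟨e, e₀ ⟨b, j⟩, by simpa using hc, ?_⟩
    rw [Module.Basis.reindex_apply, Equiv.symm_apply_apply, hB₀]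
  · refine Submodule.span_mono ?_
    rintro _ ⟨e, j, hc, rfl⟩
    refine ⟨e, _, β _ (e₀.symm j).2, hc, ?_⟩
    rw [Module.Basis.reindex_apply]
    exact hB₀ _ _ e

end Finiteness

end Sylvan

theorem corollary8p6 {𝕜 : Type*} [Field 𝕜] {n : ℕ} (I : Ideal (MvPolynomial (Fin n) 𝕜))
    (hI : Sylvan.IsMonomialIdeal I)
    (𝒞 : ∀ b : Fin n →₀ ℕ, Sylvan.Community 𝕜 (Sylvan.koszul I b)) :
    ∃ h : ∀ a b : Fin n →₀ ℕ, a < b → ∀ i, Sylvan.InducesOnHomology 𝒞 i a b,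
      Sylvan.IsMinimalFreeResolution I (Sylvan.SylvanModule I) (Sylvan.sylvanPiece I)
        (Sylvan.sylvanDifferential 𝒞 h) := by
  have h (a b : Fin n →₀ ℕ) (_ : a < b) (i : ℕ) := Sylvan.inducesOnHomology 𝒞 i a b
  exact ⟨h, Sylvan.exists_graded_basis hI,
    fun _ c _ hx => Sylvan.sylvanDifferential_homogeneous h c hx,
    Sylvan.sylvanDifferential_exact h, Sylvan.exists_augmentation hI h,
    Sylvan.range_sylvanDifferential_le h⟩
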